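/- **Setting.** There are $N$ arms, and $k$ of them are played per round, where $1\le k\le N$; the horizon is $T\ge 2$. Losses $\ell_t\in[0,1]^N$, $t=1,\dots,T$, are fixed in advance (oblivious adversary). The available sets $S_1,\dots,S_T\subseteq[N]$ are i.i.d.; each contains every arm $i$ independently with an unknown probability $a_i\in[0,1]$, i.e. $S_t\sim P_a$ with $P_a(S)=\prod_i a_i^{\mathbf 1(i\in S)}(1-a_i)^{1-\mathbf 1(i\in S)}$. **Scaled probabilities.** For weights $w\in(0,\infty)^N$ and $S\subseteq[N]$ let $p(i)=w(i)/\sum_{j\in S}w(j)$ for $i\in S$ and $p(i)=0$ otherwise. If $\max_{i\in S}p(i)\ge 1/k$, replace $p$ by the first of the following vectors ($m=1,2,\dots$) all of whose entries are at most $1/k$: the $m$ largest entries of $p$ are set to $1/k$ and the other entries are rescaled to have sum $(k-m)/k$ (remaining entries that are all zero stay zero). With $\hat p$ the resulting vector, put $q^S(i)=k\hat p(i)$ for $i\in S$ and $q^S(i)=0$ for $i\notin S$. (If $|S|<k$ this gives $q^S=\mathbf 1_S$.) **Algorithm.** Start with $w_1(i)=1$ for all $i$. In round $t$, write $q_t^S$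 for the vector $q^S$ computed from $w_t$. 1. Receive $S_t$. If $|S_t|\ge k$, decompose $q_t^{S_t}$ as a convex combination $\sum_\Omega q_\Omega\mathbf 1_\Omega$ of indicators of $k$-element sets (by any rule that maps the vector $q_t^{S_t}$ to such a decomposition, for instance the greedy mixture decomposition), and play $\Omega_t$ drawn with probability $q_{\Omega_t}$. If $|S_t|<k$, play $\Omega_t=S_t$. Observe $\ell_t(i)$ for $i\in\Omega_t$. 2. With $\hat a_t(i)=\frac1t\sum_{j=1}^t\mathbf 1(i\in S_j)$, draw $S_t^{(1)},\dots,S_t^{(t)}$ independently from $P_{\hat a_t}$ and set $\tilde q_t(i)=\frac1t\sum_{\tau=1}^t q_t^{S_t^{(\tau)}}(i)$. 3. Put $\hat\ell_t(i)=\frac{\ell_t(i)}{\tilde q_t(i)+\lambda_t}$ if $i\in\Omega_t$ and $\hat\ell_t(i)=0$ otherwise, and $w_{t+1}(i)=w_t(i)\exp(-\eta\hat\ell_t(i))$ for all $i$. **Regret.** $$R_T=\max_\pi\ \mathbb E\Big[\sum_{t=1}^T\sum_{i\in\Omega_t}\ell_t(i)-\sum_{t=1}^T\sum_{i\in\pi(S_t)}\ell_t(i)\Big],$$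 where $\pi$ ranges over the policies that assign to every $S\subseteq[N]$ a subset $\pi(S)\subseteq S$ with $\min\{k,|S|\}$ elements, and the expectation is over the availability and the randomness of the algorithm. **Lemma.** There is an absolute constant $C>0$ such that the following holds for all $N$, all $1\le k\le N$, all $T\ge 2$, all $a\in[0,1]^N$, all loss sequences $\ell_1,\dots,\ell_T\in[0,1]^N$ and all decomposition rules. If the algorithm is run with $$\lambda_t=\min\Big\{1,\ 4kN\sqrt{\tfrac{\log(2N/\delta)}{t}}+\tfrac{8kN\log(2N/\delta)}{3t}\Big\},\qquad \delta=\frac{N}{T^2},\qquad \eta=\sqrt{\frac{\ln(N/k)}{NT}},$$ then $$R_T\le C\,kN^2\sqrt{T\log T}.$$ -/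

import Mathlib

open Finset

noncomputable section

namespace SleepingBandit

/-! Arms are the elements of `Fin N`; sets of arms are `Finset (Fin N)`; rounds are `1, 2, …, T`. -/

/-- `P_a(S) = ∏ i, a i ^ 1(i ∈ S) * (1 - a i) ^ (1 - 1(i ∈ S))`: the law of a random set of arms that
contains each arm `i` independently with probability `a i`. -/
def availabilityLaw {N : ℕ} (a : Fin N → Set.Icc (0 : ℝ) 1) : PMF (Finset (Fin N)) :=
  PMF.ofFintype
    (fun S => ENNReal.ofReal (∏ i, if i ∈ S then (a i : ℝ) else 1 - (a i : ℝ)))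
    (by
      rw [← ENNReal.ofReal_sum_of_nonneg]
      · have h := Finset.prod_add (fun i => (a i : ℝ)) (fun i => 1 - (a i : ℝ)) Finset.univ
        simp only [add_sub_cancel, Finset.prod_const_one, Finset.powerset_univ] at h
        refine Eq.trans (congrArg ENNReal.ofReal ?_) ENNReal.ofReal_one
        refine Eq.trans ?_ h.symm
        refine Finset.sum_congr rfl fun S _ => ?_
        rw [Finset.prod_ite, Finset.filter_mem_eq_inter, Finset.univ_inter,
          Finset.filter_notMem_eq_sdiff]
      · intro S _
        refine Finset.prod_nonneg fun i _ => ?_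
        split_ifs
        · exact (a i).2.1
        · linarith [(a i).2.2])

/-- The law of `n` independent draws from the law `p`. -/
def iidLaw {α : Type} [Fintype α] [DecidableEq α] (n : ℕ) (p : PMF α) : PMF (Fin n → α) :=
  PMF.ofFintype (fun x => ∏ τ, p (x τ))
    (by
      have h : ∑ x, p x = 1 := (tsum_fintype (fun x => p x)).symm.trans p.tsum_coe
      rw [← Fintype.piFinset_univ, ← Finset.prod_univ_sum]
      simp [h])

/-- The empirical availability frequencies `â_t(i) = (∑_{j=1}^t 1(i ∈ S_j)) / t`. -/
def empiricalFreq {N : ℕ} (avail : ℕ → Finset (Fin N)) (t : ℕ) (i : Fin N) : Set.Icc (0 : ℝ) 1 :=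
  ⟨(#{j ∈ Icc 1 t | i ∈ avail j} : ℝ) / t, by positivity, by
    refine div_le_one_of_le₀ ?_ (Nat.cast_nonneg t)
    exact_mod_cast (Finset.card_filter_le _ _).trans (by simp)⟩

/-! ### Capped probabilities -/

/-- The weights restricted to the available set and normalized. -/
def normalized {N : ℕ} (S : Finset (Fin N)) (w : Fin N → ℝ) (i : Fin N) : ℝ :=
  if i ∈ S then w i / ∑ j ∈ S, w j else 0

/-- The `i` arms that come first when `p` is sorted in decreasing order. -/
def topArms {N : ℕ} (p : Fin N → ℝ) (i : ℕ) : Finset (Fin N) :=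
  ({m | (m : ℕ) < i} : Finset (Fin N)).image (Tuple.sort fun j => -p j)

/-- One pass of the capping loop: the `i` largest entries of `p` are set to `1 / k`, the others are
rescaled so that they sum to `(k - i) / k`. -/
def capTop {N : ℕ} (k : ℕ) (p : Fin N → ℝ) (i : ℕ) (j : Fin N) : ℝ :=
  if j ∈ topArms p i then 1 / k
  else ((k : ℝ) - i) / k * (p j / ∑ l ∈ (topArms p i)ᶜ, p l)

theorem exists_capTop_le {N : ℕ} (k : ℕ) (p : Fin N → ℝ) :
    ∃ i : ℕ, 1 ≤ i ∧ ∀ j, capTop k p i j ≤ 1 / k := by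
  refine ⟨N + 1, by omega, fun j => ?_⟩
  have hj : j ∈ topArms p (N + 1) := by
    simp only [topArms, Finset.mem_image, Finset.mem_filter, Finset.mem_univ, true_and]
    exact ⟨(Tuple.sort fun j => -p j).symm j, by omega, by simp⟩
  simp [capTop, hj]

open Classical in
/-- Capping: if some entry is at least `1 / k`, the loop runs with `i = 1, 2, …` until all
entries are at most `1 / k`; otherwise the vector is left as it is. -/
def capped {N : ℕ} (k : ℕ) (S : Finset (Fin N)) (p : Fin N → ℝ) : Fin N → ℝ :=
  if ∃ i ∈ S, 1 / (k : ℝ) ≤ p i then capTop k p (Nat.find (exists_capTop_le k p)) else p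

/-- The scaled probability vector `q^S` computed from the available set `S` and the weights `w`.
If fewer than `k` arms are available, this is the indicator vector of `S`. -/
def scaledProb {N : ℕ} (k : ℕ) (S : Finset (Fin N)) (w : Fin N → ℝ) (i : Fin N) : ℝ :=
  if i ∈ S then k * capped k S (normalized S w) i else 0

/-! ### Decomposition into corners -/

/-- `p / k` is a probability vector with entries at most `1 / k`. -/
def IsScaledCapped {N : ℕ} (k : ℕ) (p : Fin N → ℝ) : Prop :=
  (∀ i, 0 ≤ p i ∧ p i ≤ 1) ∧ ∑ i, p i = k

/-- The weights `D Ω` express `p` as a convex combination `p = ∑ Ω, D Ω • 1_Ω` of indicator vectors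
of sets `Ω` with exactly `k` elements. -/
def IsMixture {N : ℕ} (k : ℕ) (p : Fin N → ℝ) (D : PMF (Finset (Fin N))) : Prop :=
  (∀ Ω ∈ D.support, #Ω = k) ∧ ∀ i, ∑ Ω, (D Ω).toReal * (if i ∈ Ω then 1 else 0) = p i

/-- The runs of the greedy mixture decomposition: `MixtureRun k p out` says that the procedure
started at `p` can output the list `out` of pairs `(q, r)` (coefficient, corner). The corner `r` has
`k` nonzero entries and contains every entry that has the maximal possible value `(∑ i, p i) / k`
(which is `1` at the start); `s` is the smallest entry in `r` and `l` the largest one outside. -/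
inductive MixtureRun {N : ℕ} (k : ℕ) : (Fin N → ℝ) → List (ℝ × Finset (Fin N)) → Prop
  | done (p : Fin N → ℝ) (h : ¬ ∃ i, 0 < p i) : MixtureRun k p []
  | step (p : Fin N → ℝ) (r : Finset (Fin N)) (s l : ℝ) (out : List (ℝ × Finset (Fin N)))
      (hpos : ∃ i, 0 < p i) (hcard : #r = k) (hne : ∀ i ∈ r, p i ≠ 0)
      (hmax : ∀ i, p i = (∑ j, p j) / k → i ∈ r)
      (hs : IsLeast (p '' (r : Set (Fin N))) s)
      (hl : IsGreatest (insert 0 (p '' ((rᶜ : Finset (Fin N)) : Set (Fin N)))) l)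
      (next : MixtureRun k
        (fun i => p i - min s ((∑ j, p j) / k - l) * (if i ∈ r then 1 else 0)) out) :
      MixtureRun k p ((min s ((∑ j, p j) / k - l), r) :: out)

theorem mixture_step {N k : ℕ} (hk : 1 ≤ k) {p : Fin N → ℝ} {r : Finset (Fin N)} {s l : ℝ}
    (hcard : #r = k) (hs : IsLeast (p '' (r : Set (Fin N))) s)
    (hl : IsGreatest (insert 0 (p '' ((rᶜ : Finset (Fin N)) : Set (Fin N)))) l)
    (hp : ∀ i, 0 ≤ p i ∧ p i ≤ (∑ j, p j) / k) :
    0 ≤ min s ((∑ j, p j) / k - l) ∧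
    ∀ i, 0 ≤ p i - min s ((∑ j, p j) / k - l) * (if i ∈ r then 1 else 0) ∧
      p i - min s ((∑ j, p j) / k - l) * (if i ∈ r then 1 else 0) ≤
        (∑ j, (p j - min s ((∑ j, p j) / k - l) * (if j ∈ r then 1 else 0))) / k := by
  have hk0 : (0 : ℝ) < k := by exact_mod_cast hk
  set q : ℝ := min s ((∑ j, p j) / k - l) with hq
  have hsum' : (∑ j, (p j - q * (if j ∈ r then 1 else 0))) / k = (∑ j, p j) / k - q := by
    rw [Finset.sum_sub_distrib, ← Finset.mul_sum]
    simp only [Finset.sum_ite_mem, Finset.univ_inter, Finset.sum_const, nsmul_eq_mul, hcard]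
    field_simp
  obtain ⟨⟨i₀, hi₀, his⟩, hs2⟩ := hs
  have hqs : q ≤ s := min_le_left _ _
  have hql : q ≤ (∑ j, p j) / k - l := min_le_right _ _
  refine ⟨le_min (his ▸ (hp i₀).1) (sub_nonneg.2 ?_), fun i => ?_⟩
  · rcases hl.1 with h0 | ⟨i, _, hi⟩
    · rw [h0]; exact (hp i₀).1.trans (hp i₀).2
    · rw [← hi]; exact (hp i).2
  · rw [hsum']
    by_cases hir : i ∈ r
    · have h1 : s ≤ p i := hs2 ⟨i, hir, rfl⟩
      simp only [hir, if_true, mul_one]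
      exact ⟨by linarith, by linarith [(hp i).2]⟩
    · have h1 : p i ≤ l := hl.2 (Or.inr ⟨i, by simpa using hir, rfl⟩)
      simp only [hir, if_false, mul_zero, sub_zero]
      exact ⟨(hp i).1, by linarith⟩

/-- Soundness of the decomposition, for entries between `0` and one `k`-th of their sum. -/
theorem MixtureRun.sound {N k : ℕ} (hk : 1 ≤ k) {p : Fin N → ℝ} {out : List (ℝ × Finset (Fin N))}
    (h : MixtureRun k p out) (hp : ∀ i, 0 ≤ p i ∧ p i ≤ (∑ j, p j) / k) :
    (∀ x ∈ out, 0 ≤ x.1 ∧ #x.2 = k) ∧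
      ∀ i, (out.map fun x => x.1 * (if i ∈ x.2 then 1 else 0)).sum = p i := by
  have hk0 : (0 : ℝ) < k := by exact_mod_cast hk
  induction h with
  | done p h =>
    push Not at h
    exact ⟨by simp, fun i => by simp [le_antisymm (h i) (hp i).1]⟩
  | step p r s l out hpos hcard hne hmax hs hl next ih =>
    obtain ⟨hq0, hp'⟩ := mixture_step hk hcard hs hl hp
    obtain ⟨h1, h2⟩ := ih hp'
    refine ⟨?_, fun i => ?_⟩
    · intro x hx
      rcases List.mem_cons.1 hx with rfl | hx
      · exact ⟨hq0, hcard⟩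
      · exact h1 x hx
    · rw [List.map_cons, List.sum_cons, h2 i]
      ring

/-- The decomposition always has a run: no state reached from a scaled capped vector is stuck. -/
theorem exists_mixtureRun {N k : ℕ} (hk : 1 ≤ k) (p : Fin N → ℝ)
    (hp : ∀ i, 0 ≤ p i ∧ p i ≤ (∑ j, p j) / k) : ∃ out, MixtureRun k p out := by
  have hk0 : (0 : ℝ) < k := by exact_mod_cast hk
  induction hn : #{i | 0 < p i ∧ p i < (∑ j, p j) / k} using Nat.strong_induction_on
    generalizing p with
  | _ n ih =>
  by_cases hpos : ∃ i, 0 < p i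
  swap
  · exact ⟨[], .done p hpos⟩
  set m : ℝ := (∑ j, p j) / k with hm
  have hsum : ∑ j, p j = k * m := by rw [hm]; field_simp
  have hm0 : 0 < m := by
    obtain ⟨i, hi⟩ := hpos
    exact hi.trans_le (hp i).2
  have hA : #{i | p i = m} ≤ k := by
    have h1 : ∑ i ∈ ({i | p i = m} : Finset (Fin N)), p i ≤ ∑ i, p i :=
      Finset.sum_le_sum_of_subset_of_nonneg (Finset.subset_univ _) fun i _ _ => (hp i).1
    rw [Finset.sum_congr rfl (g := fun _ => m) (by simp), Finset.sum_const, nsmul_eq_mul, hsum] at h1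
    exact_mod_cast le_of_mul_le_mul_right h1 hm0
  have hB : k ≤ #{i | 0 < p i} := by
    have h1 : ∑ i ∈ ({i | 0 < p i} : Finset (Fin N)), p i = ∑ i, p i :=
      Finset.sum_subset (Finset.subset_univ _) fun i _ hi =>
        le_antisymm (by simpa using hi) (hp i).1
    have h2 : ∑ i ∈ ({i | 0 < p i} : Finset (Fin N)), p i ≤ #{i | 0 < p i} * m := by
      rw [← nsmul_eq_mul]
      exact Finset.sum_le_card_nsmul _ _ _ fun i _ => (hp i).2
    rw [h1, hsum] at h2
    exact_mod_cast le_of_mul_le_mul_right h2 hm0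
  have hAB : ({i | p i = m} : Finset (Fin N)) ⊆ ({i | 0 < p i} : Finset (Fin N)) := by
    intro i hi
    simp only [Finset.mem_filter, Finset.mem_univ, true_and] at hi ⊢
    rw [hi]; exact hm0
  obtain ⟨r, hr1, hr2, hcard⟩ := Finset.exists_subsuperset_card_eq hAB hA hB
  have hne : ∀ i ∈ r, 0 < p i := fun i hi => by simpa using hr2 hi
  have hmax : ∀ i, p i = m → i ∈ r := fun i hi => hr1 (by simpa using hi)
  have hrne : r.Nonempty := Finset.card_pos.1 (by omega)
  obtain ⟨s, hs⟩ : ∃ s, IsLeast (p '' (r : Set (Fin N))) s := by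
    obtain ⟨i, hi, h⟩ := Finset.exists_min_image r p hrne
    exact ⟨p i, ⟨i, hi, rfl⟩, by rintro _ ⟨j, hj, rfl⟩; exact h j hj⟩
  obtain ⟨l, hl⟩ : ∃ l, IsGreatest (insert 0 (p '' ((rᶜ : Finset (Fin N)) : Set (Fin N)))) l :=
    (Set.toFinite _).exists_maximal (Set.insert_nonempty _ _) |>.imp fun l h =>
      ⟨h.prop, fun x hx => (le_total x l).elim id fun hlx => h.le_of_ge hx hlx⟩
  obtain ⟨hq0, hp'⟩ := mixture_step hk hcard hs hl hp
  obtain ⟨hs1, hs2⟩ := id hs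
  obtain ⟨hl1, hl2⟩ := id hl
  set q : ℝ := min s ((∑ j, p j) / k - l) with hq
  have hsum' : (∑ j, (p j - q * (if j ∈ r then 1 else 0))) / k = m - q := by
    rw [Finset.sum_sub_distrib, ← Finset.mul_sum, hsum]
    simp only [Finset.sum_ite_mem, Finset.univ_inter, Finset.sum_const, nsmul_eq_mul, hcard]
    field_simp
  have key : #{i | 0 < p i - q * (if i ∈ r then 1 else 0) ∧
      p i - q * (if i ∈ r then 1 else 0) < m - q} < n ∨
      ∀ i, p i - q * (if i ∈ r then 1 else 0) ≤ 0 := by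
    by_cases hz : m - q ≤ 0
    · right
      intro i
      have := (hp' i).2
      rw [hsum'] at this
      linarith
    left
    push Not at hz
    rw [← hn]
    have hss : ({i | 0 < p i - q * (if i ∈ r then 1 else 0) ∧
        p i - q * (if i ∈ r then 1 else 0) < m - q} : Finset (Fin N)) ⊆
        ({i | 0 < p i ∧ p i < m} : Finset (Fin N)) := by
      intro i hi
      simp only [Finset.mem_filter, Finset.mem_univ, true_and] at hi ⊢
      by_cases hir : i ∈ r
      · simp only [hir, if_true, mul_one] at hi
        exact ⟨hne i hir, by linarith [hi.2]⟩
      · simp only [hir, if_false, mul_zero, sub_zero] at hi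
        exact ⟨hi.1, by linarith [hi.2]⟩
    refine Finset.card_lt_card (Finset.ssubset_iff_subset_ne.2 ⟨hss, fun he => ?_⟩)
    rcases min_cases s ((∑ j, p j) / k - l) with ⟨h, _⟩ | ⟨h, _⟩
    · obtain ⟨i, hi, his⟩ := hs1
      have hir : i ∈ r := hi
      have : i ∈ ({i | 0 < p i ∧ p i < m} : Finset (Fin N)) := by
        simp only [Finset.mem_filter, Finset.mem_univ, true_and]
        exact ⟨hne i hir, by rw [his]; linarith [hq.trans h]⟩
      rw [← he] at this
      simp only [Finset.mem_filter, Finset.mem_univ, true_and, hir, if_true] at this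
      linarith [hq.trans h]
    · have hql : q = m - l := hq.trans h
      rcases hl1 with h0 | ⟨i, hi, hil⟩
      · exact absurd hz (by rw [hql, h0]; simp)
      have hir : i ∉ r := by simpa using hi
      have him : p i < m := lt_of_le_of_ne (hp i).2 fun h => hir (hmax i h)
      have : i ∈ ({i | 0 < p i ∧ p i < m} : Finset (Fin N)) := by
        simp only [Finset.mem_filter, Finset.mem_univ, true_and]
        exact ⟨by rw [hil]; linarith, him⟩
      rw [← he] at this
      simp only [Finset.mem_filter, Finset.mem_univ, true_and, hir, if_false] at this
      linarith [this.2]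
  have hnext : ∃ out, MixtureRun k (fun i => p i - q * (if i ∈ r then 1 else 0)) out := by
    rcases key with key | key
    · refine ih _ key _ hp' ?_
      simp only [hsum']
    · exact ⟨[], .done _ (by push Not; exact key)⟩
  obtain ⟨out, hout⟩ := hnext
  exact ⟨_, .step p r s l out hpos hcard (fun i hi => (hne i hi).ne') hmax hs hl hout⟩

/-- A run started at a scaled capped vector outputs a mixture: the law that selects each corner
with its coefficient. -/
theorem MixtureRun.exists_isMixture {N k : ℕ} (hk : 1 ≤ k) {p : Fin N → ℝ}
    {out : List (ℝ × Finset (Fin N))} (h : MixtureRun k p out) (hp : IsScaledCapped k p) :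
    ∃ D : PMF (Finset (Fin N)), IsMixture k p D ∧
      ∀ Ω, D Ω = ENNReal.ofReal (out.map fun x => if x.2 = Ω then x.1 else 0).sum := by
  have hk0 : (0 : ℝ) < k := by exact_mod_cast hk
  obtain ⟨h1, h2⟩ := h.sound hk fun i => ⟨(hp.1 i).1, by
    rw [hp.2, div_self hk0.ne']; exact (hp.1 i).2⟩
  have hnn : ∀ Ω : Finset (Fin N), 0 ≤ (out.map fun x => if x.2 = Ω then x.1 else 0).sum := by
    intro Ω
    refine List.sum_nonneg fun y hy => ?_
    obtain ⟨x, hx, rfl⟩ := List.mem_map.1 hy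
    split_ifs
    · exact (h1 x hx).1
    · exact le_rfl
  have hswap : ∀ f : Finset (Fin N) → ℝ,
      ∑ Ω, (out.map fun x => if x.2 = Ω then x.1 else 0).sum * f Ω =
        (out.map fun x => x.1 * f x.2).sum := by
    intro f
    clear h h1 h2 hnn
    induction out with
    | nil => simp
    | cons x out ih => simp [add_mul, Finset.sum_add_distrib, ih]
  have hone : ∑ Ω : Finset (Fin N), (out.map fun x => if x.2 = Ω then x.1 else 0).sum = 1 := by
    have e1 := hswap fun Ω => (#Ω : ℝ)
    have e2 : (out.map fun x => x.1 * (#x.2 : ℝ)).sum = k := by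
      rw [← hp.2, ← Finset.sum_congr rfl fun i _ => h2 i]
      clear h h1 h2 hnn hswap e1 hp
      induction out with
      | nil => simp
      | cons x out ih => simp_all [Finset.sum_add_distrib, mul_comm]
    have e3 : (out.map fun x => x.1 * (#x.2 : ℝ)).sum = (out.map fun x => x.1 * (k : ℝ)).sum := by
      congr 1
      exact List.map_congr_left fun x hx => by rw [(h1 x hx).2]
    have e4 := hswap fun _ => (k : ℝ)
    rw [← Finset.sum_mul, ← e3, e2] at e4
    exact mul_right_cancel₀ hk0.ne' (e4.trans (one_mul _).symm)
  refine ⟨PMF.ofFintype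
    (fun Ω => ENNReal.ofReal (out.map fun x => if x.2 = Ω then x.1 else 0).sum) ?_, ⟨?_, ?_⟩, ?_⟩
  · rw [← ENNReal.ofReal_sum_of_nonneg fun Ω _ => hnn Ω, hone, ENNReal.ofReal_one]
  · intro Ω hΩ
    by_contra hc
    rw [PMF.mem_support_iff, PMF.ofFintype_apply] at hΩ
    apply hΩ
    rw [List.sum_eq_zero, ENNReal.ofReal_zero]
    intro y hy
    obtain ⟨x, hx, rfl⟩ := List.mem_map.1 hy
    refine if_neg fun e => hc ?_
    rw [← e]
    exact (h1 x hx).2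
  · intro i
    simp only [PMF.ofFintype_apply]
    rw [Finset.sum_congr rfl fun Ω _ => by rw [ENNReal.toReal_ofReal (hnn Ω)]]
    rw [hswap fun Ω => if i ∈ Ω then 1 else 0]
    exact h2 i
  · intro Ω
    rfl

/-- Every scaled capped vector has a mixture decomposition. -/
theorem exists_isMixture {N k : ℕ} (hk : 1 ≤ k) (p : Fin N → ℝ) (hp : IsScaledCapped k p) :
    ∃ D : PMF (Finset (Fin N)), IsMixture k p D := by
  have hk0 : (k : ℝ) ≠ 0 := by positivity
  obtain ⟨out, h⟩ := exists_mixtureRun hk p fun i => ⟨(hp.1 i).1, by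
    rw [hp.2, div_self hk0]; exact (hp.1 i).2⟩
  exact (h.exists_isMixture hk hp).imp fun D hD => hD.1

/-! ### The algorithm -/

/-- The state after some rounds: current weights, and the available and played sets by round. -/
structure State (N : ℕ) where
  weight : Fin N → ℝ
  avail : ℕ → Finset (Fin N)
  play : ℕ → Finset (Fin N)

instance (N : ℕ) : MeasurableSpace (State N) := ⊤

/-- The law of the played set, given the available set `S` and the weights `w`: it is drawn from the
mixture decomposition `rule q` of the scaled probability vector `q`; if fewer than `k` arms are
available, all of them are played. -/
def playLaw {N : ℕ} (k : ℕ) (rule : (Fin N → ℝ) → PMF (Finset (Fin N)))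
    (S : Finset (Fin N)) (w : Fin N → ℝ) : PMF (Finset (Fin N)) :=
  if k ≤ #S then rule (scaledProb k S w) else PMF.pure S

/-- The Monte Carlo estimate `q̃_t(i) = (1 / t) ∑_{τ=1}^t q_t^{S_t^(τ)}(i)`. -/
def monteCarlo {N : ℕ} (k t : ℕ) (w : Fin N → ℝ) (x : Fin t → Finset (Fin N)) (i : Fin N) : ℝ :=
  (1 / (t : ℝ)) * ∑ τ, scaledProb k (x τ) w i

/-- The estimated loss. -/
def lossEstimate {N : ℕ} (Ω : Finset (Fin N)) (loss q : Fin N → ℝ) (lam : ℝ) (i : Fin N) : ℝ :=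
  if i ∈ Ω then loss i / (q i + lam) else 0

/-- Round `t` of the algorithm, started in the state `st`: receive the available set `S`, play
`Ω`, draw `t` independent sets from the empirical availability law, and update the weights. -/
def round {N : ℕ} (k : ℕ) (rule : (Fin N → ℝ) → PMF (Finset (Fin N)))
    (a : Fin N → Set.Icc (0 : ℝ) 1) (ℓ : ℕ → Fin N → ℝ) (lam : ℕ → ℝ) (η : ℝ)
    (t : ℕ) (st : State N) : PMF (State N) :=
  (availabilityLaw a).bind fun S =>
  (playLaw k rule S st.weight).bind fun Ω =>
  (iidLaw t (availabilityLaw (empiricalFreq (Function.update st.avail t S) t))).bind fun x =>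
  PMF.pure
    { weight := fun i => st.weight i *
        Real.exp (-η * lossEstimate Ω (ℓ t) (monteCarlo k t st.weight x) (lam t) i)
      avail := Function.update st.avail t S
      play := Function.update st.play t Ω }

/-- The law of the state after `T` rounds, started with all weights equal to `1`. -/
def run {N : ℕ} (k : ℕ) (rule : (Fin N → ℝ) → PMF (Finset (Fin N)))
    (a : Fin N → Set.Icc (0 : ℝ) 1) (ℓ : ℕ → Fin N → ℝ) (lam : ℕ → ℝ) (η : ℝ) :
    ℕ → PMF (State N)
  | 0 => PMF.pure ⟨fun _ => 1, fun _ => ∅, fun _ => ∅⟩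
  | t + 1 => (run k rule a ℓ lam η t).bind (round k rule a ℓ lam η (t + 1))

/-- Policies choose `k` of the available arms (all of them if fewer than `k` are available). -/
def Policy (N k : ℕ) : Type :=
  {π : Finset (Fin N) → Finset (Fin N) // ∀ S, π S ⊆ S ∧ #(π S) = min k #S}

instance (N k : ℕ) : Finite (Policy N k) := by unfold Policy; infer_instance

instance (N k : ℕ) : Nonempty (Policy N k) := by
  choose π hπ using fun S : Finset (Fin N) =>
    Finset.exists_subset_card_eq (min_le_right k #S)
  exact ⟨⟨π, hπ⟩⟩

/-- The regret after `T` rounds: the maximum, over the finitely many policies `π`, of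
`E[∑_{t=1}^T ∑_{i ∈ Ω_t} ℓ_t(i) - ∑_{t=1}^T ∑_{i ∈ π(S_t)} ℓ_t(i)]`. -/
def regret {N : ℕ} (k : ℕ) (rule : (Fin N → ℝ) → PMF (Finset (Fin N)))
    (a : Fin N → Set.Icc (0 : ℝ) 1) (ℓ : ℕ → Fin N → ℝ) (lam : ℕ → ℝ) (η : ℝ) (T : ℕ) : ℝ :=
  ⨆ π : Policy N k, ∫ st, ((∑ t ∈ Icc 1 T, ∑ i ∈ st.play t, ℓ t i)
    - ∑ t ∈ Icc 1 T, ∑ i ∈ π.1 (st.avail t), ℓ t i) ∂(run k rule a ℓ lam η T).toMeasure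

/-- `λ_t = min {1, 4 k N √(log (2 N / δ) / t) + 8 k N log (2 N / δ) / (3 t)}`. -/
def lamParam (N k : ℕ) (δ : ℝ) (t : ℕ) : ℝ :=
  min 1 (4 * k * N * √(Real.log (2 * N / δ) / t) + 8 * k * N * Real.log (2 * N / δ) / (3 * t))

/-- `δ = N / T²`. -/
def deltaParam (N T : ℕ) : ℝ := N / (T : ℝ) ^ 2

/-- `η = √(ln (N / k) / (N T))`. -/
def etaParam (N k T : ℕ) : ℝ := √(Real.log (N / k) / (N * T))

end SleepingBandit

end

noncomputable section

namespace SleepingBandit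

/-! ### The capping loop and the closed form of the scaled probabilities. -/

section Capping

variable {N : ℕ}

/-! The algorithm is entropic mirror descent on the capped simplex, run for all available sets at
once. Capping amounts to `q^S(i) = min 1 (c * w i)` with total `min k #S` (`exists_scaledProb_eq`).
These are the optimality conditions for minimizing `∑ u (log u - log w)` over vectors on `S` with
that total and entries in `[0, 1]`. The minimum is `potential k S w`, and the excess of any
competitor is at least a Bregman divergence (`potential_add_le`).

For a policy `π`, let `Ψ(w)` be the mean, over a fresh set `S`, of `potential k S w + ∑ i ∈ π S, log
(w i)`. Testing the minimum against the indicator of `π S` gives `Ψ ≤ 0`, while `Ψ ≥ -k log (N / k)`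
at the initial weights. An update by loss estimates `g ≥ 0` raises `Ψ` by at least `∑ (Q (η g - (η
g)²) - P η g)`, where `Q` and `P` are the probabilities, averaged over `S`, that the algorithm and
`π` play an arm. Telescoping therefore bounds the estimated regret by `k log (N / k) / η` plus a
term quadratic in `g`.

To pass to true losses, `q̃_t` must be within `λ_t` of `Q`. The two depend on common randomness,
since `S_t` enters the empirical frequencies, so the estimates are not treated as unbiased. Instead
they are compared pointwise with `ℓ / Q` and `ℓ / (Q + 2 λ)` off a bad event, and crudely on it. The
bad event is rare by Hoeffding's inequality, applied once to the Monte Carlo draws and once to each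
empirical frequency, together with a total variation bound for product laws (`missProb_le`). The
dominant error is `2 N ∑ λ_t`, of order `k N² √(T log T)`. -/

theorem topArms_succ (p : Fin N → ℝ) {m : ℕ} (hm : m < N) :
    topArms p (m + 1) = insert (Tuple.sort (fun j => -p j) ⟨m, hm⟩) (topArms p m) := by
  rw [topArms, topArms, ← Finset.image_insert]
  congr 1
  ext x
  simp only [Finset.mem_filter, Finset.mem_univ, true_and, Finset.mem_insert, Fin.ext_iff]
  omega

theorem sort_notMem_topArms (p : Fin N → ℝ) {m : ℕ} (hm : m < N) :
    Tuple.sort (fun j => -p j) ⟨m, hm⟩ ∉ topArms p m := by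
  simp [topArms]

theorem card_topArms (p : Fin N → ℝ) {m : ℕ} (hm : m ≤ N) : #(topArms p m) = m := by
  induction m with
  | zero => simp [topArms]
  | succ m ih => 
    rw [topArms_succ p (by omega), Finset.card_insert_of_notMem (sort_notMem_topArms p _),
      ih (by omega)]

theorem topArms_eq_univ (p : Fin N → ℝ) {m : ℕ} (hm : N ≤ m) : topArms p m = univ := by
  ext j
  simp only [topArms, Finset.mem_image, Finset.mem_filter, Finset.mem_univ, true_and, iff_true]
  exact ⟨(Tuple.sort fun j => -p j).symm j, by omega, by simp⟩

theorem le_of_mem_topArms (p : Fin N → ℝ) {m : ℕ} {i j : Fin N} (hi : i ∈ topArms p m)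
    (hj : j ∉ topArms p m) : p j ≤ p i := by
  simp only [topArms, Finset.mem_image, Finset.mem_filter, Finset.mem_univ, true_and] at hi hj
  obtain ⟨x, hx, rfl⟩ := hi
  have h1 : m ≤ ((Tuple.sort fun j => -p j).symm j : ℕ) := by
    by_contra h
    exact hj ⟨(Tuple.sort fun j => -p j).symm j, by omega, by simp⟩
  have h2 := Tuple.monotone_sort (fun j => -p j)
    (show x ≤ (Tuple.sort fun j => -p j).symm j from Fin.le_def.2 (by omega))
  simp only [Function.comp_apply, Equiv.apply_symm_apply] at h2
  linarith

/-- At pass `k` the rescaling factor `k - k` vanishes, so the loop stops no later than that. -/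
theorem capTop_self_le (k : ℕ) (p : Fin N → ℝ) (j : Fin N) : capTop k p k j ≤ 1 / k := by
  unfold capTop
  split_ifs <;> simp

/-- The first entry set to `1 / k` in the last pass of the capping loop exceeds `1 / k` also after
rescaling by the factor of that pass. -/
theorem compl_topArms_sum_le {k : ℕ} (hk : 1 ≤ k) {p : Fin N → ℝ} (hp : ∀ i, 0 ≤ p i)
    (hsum : ∑ i, p i = 1) (hcap : ∃ i, 1 / (k : ℝ) ≤ p i) {m : ℕ}
    (hm : m = Nat.find (exists_capTop_le k p)) (hR : 0 < ∑ l ∈ (topArms p m)ᶜ, p l)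
    {i : Fin N} (hi : i ∈ topArms p m) :
    ∑ l ∈ (topArms p m)ᶜ, p l ≤ ((k : ℝ) - m) * p i := by
  have hk0 : (0 : ℝ) < k := by exact_mod_cast hk
  have hspec := Nat.find_spec (exists_capTop_le k p)
  have hmin := fun n => Nat.find_min (m := n) (exists_capTop_le k p)
  have hmk := Nat.find_min' (exists_capTop_le k p) ⟨hk, capTop_self_le k p⟩
  rw [← hm] at hspec hmk hmin
  have hmN : m < N := by
    by_contra h
    rw [topArms_eq_univ p (by omega)] at hR
    simp at hR
  obtain ⟨n, rfl⟩ : ∃ n, m = n + 1 := ⟨m - 1, by omega⟩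
  set i₀ := Tuple.sort (fun j => -p j) ⟨n, by omega⟩ with hi₀
  have hA : topArms p (n + 1) = insert i₀ (topArms p n) := topArms_succ p (by omega)
  have hi₀A : i₀ ∉ topArms p n := sort_notMem_topArms p _
  have hR' : ∑ l ∈ (topArms p n)ᶜ, p l = p i₀ + ∑ l ∈ (topArms p (n + 1))ᶜ, p l := by
    have h1 := Finset.sum_compl_add_sum (topArms p n) p
    have h2 := Finset.sum_compl_add_sum (topArms p (n + 1)) p
    rw [hA, Finset.sum_insert hi₀A, ← hA] at h2
    linarith
  have hle : ∀ j, j ∉ topArms p n → p j ≤ p i₀ := by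
    intro j hj
    by_cases h : j = i₀
    · rw [h]
    · exact le_of_mem_topArms p (m := n + 1) (by simp [hA]) (by simp [hA, h, hj])
  have hik : p i₀ ≤ p i := by
    by_cases h : i = i₀
    · rw [h]
    · rw [hA, Finset.mem_insert] at hi
      exact le_of_mem_topArms p (hi.resolve_left h) hi₀A
  have hkm : (0 : ℝ) ≤ (k : ℝ) - (n + 1 : ℕ) := by
    rw [sub_nonneg]; exact_mod_cast hmk
  refine le_trans ?_ (mul_le_mul_of_nonneg_left hik hkm)
  push_cast at hkm ⊢
  -- If `n = 0`, the bound comes from the condition for entering the loop. Otherwise pass `n` failed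
  -- at some entry `j` outside its top `n`, which bounds the remaining mass before `i₀` is removed
  -- by `(k - n) * p j ≤ (k - n) * p i₀`.
  rcases Nat.eq_zero_or_pos n with h0 | hpos
  · obtain ⟨j, hj⟩ := hcap
    have h1 : p j ≤ p i₀ := hle j (by simp [h0, topArms])
    have h2 : ∑ l ∈ (topArms p n)ᶜ, p l = 1 := by rw [← hsum]; simp [h0, topArms]
    have h3 : 1 ≤ k * p i₀ := by
      have := hj.trans h1
      rw [div_le_iff₀ hk0] at this
      linarith
    rw [h2] at hR'
    simp only [h0, Nat.cast_zero] at hR' ⊢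
    linarith
  · have h1 := hmin n (by omega)
    push Not at h1
    obtain ⟨j, hj⟩ := h1 hpos
    have hjA : j ∉ topArms p n := by
      intro h
      simp [capTop, h] at hj
    rw [capTop, if_neg hjA] at hj
    have hRpos : 0 < ∑ l ∈ (topArms p n)ᶜ, p l := by rw [hR']; linarith [hp i₀]
    have h2 : ∑ l ∈ (topArms p n)ᶜ, p l < ((k : ℝ) - n) * p j := by
      have : ((k : ℝ) - n) / k * (p j / ∑ l ∈ (topArms p n)ᶜ, p l) =
        1 / k * (((k : ℝ) - n) * p j / ∑ l ∈ (topArms p n)ᶜ, p l) := by ring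
      rw [this, lt_mul_iff_one_lt_right (by positivity), one_lt_div hRpos] at hj
      exact hj
    have h3 : ((k : ℝ) - n) * p j ≤ ((k : ℝ) - n) * p i₀ :=
      mul_le_mul_of_nonneg_left (hle j hjA) (by linarith)
    linarith

/-- The scaled probabilities truncate a multiple of the weights at `1`. -/
theorem exists_scaledProb_eq {k : ℕ} (hk : 1 ≤ k) (S : Finset (Fin N)) {w : Fin N → ℝ}
    (hw : ∀ i, 0 < w i) :
    ∃ c : ℝ, 0 < c ∧ (∀ i ∈ S, scaledProb k S w i = min 1 (c * w i)) ∧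
      ∑ i ∈ S, scaledProb k S w i = min k #S := by
  classical
  have hk0 : (0 : ℝ) < k := by exact_mod_cast hk
  rcases S.eq_empty_or_nonempty with rfl | hS
  · exact ⟨1, one_pos, by simp, by simp⟩
  set p := normalized S w with hpdef
  have hW : 0 < ∑ j ∈ S, w j := Finset.sum_pos (fun i _ => hw i) hS
  have hpS : ∀ i ∈ S, p i = w i / ∑ j ∈ S, w j := fun i hi => if_pos hi
  have hpS0 : ∀ i, i ∉ S → p i = 0 := fun i hi => if_neg hi
  have hppos : ∀ i ∈ S, 0 < p i := fun i hi => by rw [hpS i hi]; exact div_pos (hw i) hW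
  have hp : ∀ i, 0 ≤ p i := fun i => by
    by_cases h : i ∈ S
    · exact (hppos i h).le
    · rw [hpS0 i h]
  have hsumS : ∑ i ∈ S, p i = 1 := by
    rw [Finset.sum_congr rfl hpS, ← Finset.sum_div, div_self hW.ne']
  have hsum : ∑ i, p i = 1 := by
    rw [← hsumS]
    exact (Finset.sum_subset (Finset.subset_univ S) fun i _ h => hpS0 i h).symm
  by_cases hcap : ∃ i ∈ S, 1 / (k : ℝ) ≤ p i
  swap
  · have hq : ∀ i ∈ S, scaledProb k S w i = k * p i := fun i hi => by
      rw [scaledProb, if_pos hi, capped, if_neg hcap]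
    push Not at hcap
    refine ⟨k / ∑ j ∈ S, w j, by positivity, fun i hi => ?_, ?_⟩
    · have h1 : k * p i ≤ 1 := by
        have := (hcap i hi).le
        rw [le_div_iff₀ hk0] at this
        linarith
      have h2 : k / (∑ j ∈ S, w j) * w i = k * p i := by rw [hpS i hi]; ring
      rw [h2, hq i hi, min_eq_right h1]
    · rw [Finset.sum_congr rfl hq, ← Finset.mul_sum, hsumS, mul_one]
      -- Entries below `1 / k` that sum to `1` force `k ≤ #S`.
      have h1 : (1 : ℝ) ≤ #S * (1 / k) := by
        rw [← nsmul_eq_mul]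
        refine hsumS.symm.le.trans ?_
        exact Finset.sum_le_card_nsmul _ _ _ fun i hi => (hcap i hi).le
      rw [mul_one_div, le_div_iff₀ hk0, one_mul] at h1
      rw [min_eq_left (by exact_mod_cast h1)]
  set m := Nat.find (exists_capTop_le k p) with hm
  have hq : ∀ i ∈ S, scaledProb k S w i = k * capTop k p m i := fun i hi => by
    rw [scaledProb, if_pos hi, capped, if_pos hcap]
  have hspec := Nat.find_spec (exists_capTop_le k p)
  have hmk := Nat.find_min' (exists_capTop_le k p) ⟨hk, capTop_self_le k p⟩
  rw [← hm] at hspec hmk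
  have hqA : ∀ i ∈ S, i ∈ topArms p m → scaledProb k S w i = 1 := fun i hi hA => by
    rw [hq i hi, capTop, if_pos hA]; field_simp
  have hR0 : 0 ≤ ∑ l ∈ (topArms p m)ᶜ, p l := Finset.sum_nonneg fun i _ => hp i
  -- If no mass is left outside the top arms, all of `S` is capped; the quotient in `capTop` is then
  -- a division by zero and must be kept out of the argument.
  rcases hR0.eq_or_lt with hR | hR
  · have hSA : S ⊆ topArms p m := by
      intro i hi
      by_contra h
      have := (Finset.sum_eq_zero_iff_of_nonneg (fun i _ => hp i)).1 hR.symm i (by simpa using h)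
      exact (hppos i hi).ne' this
    have hcard : #S ≤ k := by
      rcases le_or_gt m N with h | h
      · exact (Finset.card_le_card hSA).trans ((card_topArms p h).le.trans hmk)
      · exact (Finset.card_le_univ S).trans (by simp; omega)
    -- Any `c` with `c * w i ≥ 1` on `S` serves; the sum of the inverse weights is one.
    refine ⟨∑ i ∈ S, (w i)⁻¹, Finset.sum_pos (fun i _ => inv_pos.2 (hw i)) hS, fun i hi => ?_, ?_⟩
    · rw [hqA i hi (hSA hi), min_eq_left]
      have h1 : (w i)⁻¹ ≤ ∑ i ∈ S, (w i)⁻¹ :=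
        Finset.single_le_sum (f := fun i => (w i)⁻¹) (fun i _ => (inv_pos.2 (hw i)).le) hi
      calc (1 : ℝ) = (w i)⁻¹ * w i := (inv_mul_cancel₀ (hw i).ne').symm
        _ ≤ _ := mul_le_mul_of_nonneg_right h1 (hw i).le
    · rw [Finset.sum_congr rfl fun i hi => hqA i hi (hSA hi)]
      simp [hcard]
  · have hcap' : ∃ i, 1 / (k : ℝ) ≤ p i := hcap.imp fun i h => h.2
    have hkey := fun i => compl_topArms_sum_le hk hp hsum hcap' hm hR (i := i)
    set A := topArms p m with hA
    set R := ∑ l ∈ Aᶜ, p l with hRdef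
    have hmN : m < N := by
      by_contra h
      rw [hRdef, hA, topArms_eq_univ p (by omega)] at hR
      simp at hR
    have hAcard : #A = m := card_topArms p hmN.le
    obtain ⟨i₁, hi₁⟩ : A.Nonempty := Finset.card_pos.1 (by omega)
    have hmk' : (0 : ℝ) < k - m :=
      pos_of_mul_pos_left (hR.trans_le (hkey i₁ hi₁)) (hp i₁)
    have hAS : A ⊆ S := by
      intro i hi
      by_contra h
      have := hkey i hi
      rw [hpS0 i h] at this
      linarith
    have hqAc : ∀ i ∈ S, i ∉ A → scaledProb k S w i = (k - m) * p i / R := fun i hi h => by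
      rw [hq i hi, capTop, if_neg h, ← hA, ← hRdef]; field_simp
    have hq1 : ∀ i ∈ S, scaledProb k S w i ≤ 1 := fun i hi => by
      rw [hq i hi]
      have := hspec.2 i
      rw [le_div_iff₀ hk0] at this
      linarith
    have hsumq : ∑ i ∈ S, scaledProb k S w i = k := by
      rw [← Finset.sum_sdiff hAS, Finset.sum_congr rfl fun i hi => hqA i (hAS hi) hi,
        Finset.sum_congr rfl fun i hi => hqAc i (Finset.mem_sdiff.1 hi).1 (Finset.mem_sdiff.1 hi).2,
        ← Finset.sum_div, ← Finset.mul_sum]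
      have : ∑ i ∈ S \ A, p i = R := by
        refine Finset.sum_subset (fun i hi => ?_) fun i hi h => hpS0 i fun hiS => h ?_
        · simpa using (Finset.mem_sdiff.1 hi).2
        · exact Finset.mem_sdiff.2 ⟨hiS, by simpa using hi⟩
      rw [this, mul_div_assoc, div_self hR.ne', Finset.sum_const, hAcard]
      simp
    -- This `c` is the factor of the last pass. That `c * w i ≥ 1` on the capped arms is
    -- `compl_topArms_sum_le`.
    refine ⟨(k - m) / R / ∑ j ∈ S, w j, by positivity, fun i hi => ?_, ?_⟩
    · have h2 : (k - m) / R / (∑ j ∈ S, w j) * w i = (k - m) * p i / R := by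
        rw [hpS i hi]; field_simp
      rw [h2]
      by_cases h : i ∈ A
      · rw [hqA i hi h, min_eq_left]
        rw [one_le_div hR]
        exact hkey i h
      · rw [← hqAc i hi h, min_eq_right (hq1 i hi)]
    · have h1 : (k : ℝ) ≤ #S := by
        rw [← hsumq]
        exact (Finset.sum_le_card_nsmul _ _ _ hq1).trans (by simp)
      rw [hsumq, min_eq_left (by exact_mod_cast h1)]

theorem scaledProb_of_notMem {k : ℕ} {S : Finset (Fin N)} {w : Fin N → ℝ} {i : Fin N}
    (hi : i ∉ S) : scaledProb k S w i = 0 := if_neg hi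

theorem scaledProb_pos {k : ℕ} (hk : 1 ≤ k) {S : Finset (Fin N)} {w : Fin N → ℝ}
    (hw : ∀ i, 0 < w i) {i : Fin N} (hi : i ∈ S) : 0 < scaledProb k S w i := by
  obtain ⟨c, hc, h, -⟩ := exists_scaledProb_eq hk S hw
  rw [h i hi]
  exact lt_min one_pos (mul_pos hc (hw i))

theorem scaledProb_mem_Icc {k : ℕ} (hk : 1 ≤ k) (S : Finset (Fin N)) {w : Fin N → ℝ}
    (hw : ∀ i, 0 < w i) (i : Fin N) : scaledProb k S w i ∈ Set.Icc (0 : ℝ) 1 := by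
  by_cases hi : i ∈ S
  · obtain ⟨c, hc, h, -⟩ := exists_scaledProb_eq hk S hw
    exact ⟨(scaledProb_pos hk hw hi).le, by rw [h i hi]; exact min_le_left _ _⟩
  · rw [scaledProb_of_notMem hi]; simp

theorem sum_scaledProb {k : ℕ} (hk : 1 ≤ k) (S : Finset (Fin N)) {w : Fin N → ℝ}
    (hw : ∀ i, 0 < w i) : ∑ i ∈ S, scaledProb k S w i = min k #S :=
  (exists_scaledProb_eq hk S hw).choose_spec.2.2

/-- Entries at most `1` with total `#S` are all `1`. -/
theorem scaledProb_of_card_le {k : ℕ} (hk : 1 ≤ k) {S : Finset (Fin N)} (hS : #S ≤ k)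
    {w : Fin N → ℝ} (hw : ∀ i, 0 < w i) (i : Fin N) :
    scaledProb k S w i = if i ∈ S then 1 else 0 := by
  split_ifs with hi
  · have h1 : ∑ i ∈ S, scaledProb k S w i = ∑ i ∈ S, (1 : ℝ) := by
      rw [sum_scaledProb hk S hw]; simp [hS]
    exact (Finset.sum_eq_sum_iff_of_le fun i _ => (scaledProb_mem_Icc hk S hw i).2).1 h1 i hi
  · exact scaledProb_of_notMem hi

theorem isScaledCapped_scaledProb {k : ℕ} (hk : 1 ≤ k) {S : Finset (Fin N)} (hS : k ≤ #S)
    {w : Fin N → ℝ} (hw : ∀ i, 0 < w i) : IsScaledCapped k (scaledProb k S w) := by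
  refine ⟨fun i => scaledProb_mem_Icc hk S hw i, ?_⟩
  rw [← Finset.sum_subset (Finset.subset_univ S) fun i _ h => scaledProb_of_notMem h,
    sum_scaledProb hk S hw, min_eq_left (by exact_mod_cast hS)]

end Capping

/-! ### The potential -/

section Potential

variable {N : ℕ}

/-- The optimal value of `∑ i ∈ S, q i * (log (q i) - log (w i))`, attained at the scaled
probabilities. -/
def potential (k : ℕ) (S : Finset (Fin N)) (w : Fin N → ℝ) : ℝ :=
  ∑ i ∈ S, scaledProb k S w i * (Real.log (scaledProb k S w i) - Real.log (w i))

theorem sub_le_mul_log_sub_log {x z : ℝ} (hx : 0 ≤ x) (hz : 0 < z) :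
    x - z ≤ x * (Real.log x - Real.log z) := by
  rcases hx.eq_or_lt with rfl | hx
  · simp [hz.le]
  · have h := Real.log_le_sub_one_of_pos (div_pos hz hx)
    rw [Real.log_div hz.ne' hx.ne'] at h
    have h2 := mul_le_mul_of_nonneg_left h hx.le
    have h3 : x * (z / x - 1) = z - x := by field_simp
    linarith

/-- It follows from `exp y ≥ 1 + y` and `(1 - y + y²)(1 + y) = 1 + y³`. No upper bound on `y` is
needed, so `η` times a loss estimate may be large. -/
theorem exp_neg_le {y : ℝ} (hy : 0 ≤ y) : Real.exp (-y) ≤ 1 - y + y ^ 2 := by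
  have h : 0 < 1 + y := by linarith
  have h1 : 1 + y ≤ Real.exp y := by linarith [Real.add_one_le_exp y]
  rw [Real.exp_neg]
  calc (Real.exp y)⁻¹ ≤ (1 + y)⁻¹ := inv_anti₀ h h1
    _ ≤ 1 - y + y ^ 2 := by
      rw [inv_le_iff_one_le_mul₀ h]
      nlinarith [pow_nonneg hy 3]

/-- The scaled probabilities minimize relative entropy; the Bregman gap is explicit. -/
theorem potential_add_le {k : ℕ} (hk : 1 ≤ k) (S : Finset (Fin N)) {w : Fin N → ℝ}
    (hw : ∀ i, 0 < w i) {u : Fin N → ℝ} (hu : ∀ i ∈ S, u i ≤ 1)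
    (hsum : ∑ i ∈ S, u i = min k #S) :
    potential k S w + ∑ i ∈ S, (u i * (Real.log (u i) - Real.log (scaledProb k S w i))
      - u i + scaledProb k S w i) ≤ ∑ i ∈ S, u i * (Real.log (u i) - Real.log (w i)) := by
  obtain ⟨c, hc, hq, hqs⟩ := exists_scaledProb_eq hk S hw
  set q := scaledProb k S w with hqdef
  -- The totals of `u` and `q` agree, so the Lagrange multiplier `1 + log c` can be added for free;
  -- the inequality then holds arm by arm.
  have hzero : ∑ i ∈ S, (u i - q i) * (1 + Real.log c) = 0 := by
    rw [← Finset.sum_mul, Finset.sum_sub_distrib, hsum, hqs, sub_self, zero_mul]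
  rw [← add_zero (potential k S w + _), ← hzero, potential, ← hqdef, ← Finset.sum_add_distrib,
    ← Finset.sum_add_distrib]
  refine Finset.sum_le_sum fun i hi => ?_
  -- Complementary slackness: either `q i = c * w i` and the second factor is zero, or `q i = 1` and
  -- both factors are nonpositive.
  have key : 0 ≤ (u i - q i) * (Real.log (q i) - Real.log (w i) - Real.log c) := by
    have hcw : Real.log (c * w i) = Real.log c + Real.log (w i) :=
      Real.log_mul hc.ne' (hw i).ne'
    rcases le_total 1 (c * w i) with h | h
    · have hqi : q i = 1 := by rw [hq i hi, min_eq_left h]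
      have := Real.log_nonneg h
      rw [hqi, Real.log_one]
      exact mul_nonneg_of_nonpos_of_nonpos (by linarith [hu i hi]) (by linarith)
    · have hqi : q i = c * w i := by rw [hq i hi, min_eq_right h]
      rw [hqi, hcw]
      simp
  linarith

/-- The new minimizer `u` is used as a competitor for the old weights. The gain is then the
divergence of `u` from the old `q` plus `∑ u η g`. Its least value over all nonnegative `u` is `∑ q
(1 - exp (-η g))`, attained at `q exp (-η g)`. -/
theorem potential_update_le {k : ℕ} (hk : 1 ≤ k) (S : Finset (Fin N)) {w g : Fin N → ℝ} {η : ℝ}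
    (hw : ∀ i, 0 < w i) (hη : 0 ≤ η) (hg : ∀ i, 0 ≤ g i) :
    potential k S w + ∑ i ∈ S, scaledProb k S w i * (η * g i - (η * g i) ^ 2) ≤
      potential k S fun i => w i * Real.exp (-η * g i) := by
  have hw' : ∀ i, 0 < w i * Real.exp (-η * g i) := fun i => mul_pos (hw i) (Real.exp_pos _)
  set u := scaledProb k S fun i => w i * Real.exp (-η * g i) with hu
  have h1 := potential_add_le hk S hw (u := u) (fun i _ => (scaledProb_mem_Icc hk S hw' i).2)
    (sum_scaledProb hk S hw')
  have h2 : potential k S (fun i => w i * Real.exp (-η * g i)) =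
      ∑ i ∈ S, u i * (Real.log (u i) - Real.log (w i)) + ∑ i ∈ S, u i * (η * g i) := by
    rw [potential, ← Finset.sum_add_distrib]
    refine Finset.sum_congr rfl fun i _ => ?_
    rw [Real.log_mul (hw i).ne' (Real.exp_pos _).ne', Real.log_exp]
    ring
  have h3 : ∑ i ∈ S, scaledProb k S w i * (η * g i - (η * g i) ^ 2) ≤
      ∑ i ∈ S, (u i * (Real.log (u i) - Real.log (scaledProb k S w i))
        - u i + scaledProb k S w i) + ∑ i ∈ S, u i * (η * g i) := by
    rw [← Finset.sum_add_distrib]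
    refine Finset.sum_le_sum fun i hi => ?_
    have hq := scaledProb_pos hk hw hi
    have h4 := sub_le_mul_log_sub_log (scaledProb_mem_Icc hk S hw' i).1
      (mul_pos hq (Real.exp_pos (-(η * g i))))
    rw [← hu, Real.log_mul hq.ne' (Real.exp_pos _).ne', Real.log_exp] at h4
    have h5 := mul_le_mul_of_nonneg_left (exp_neg_le (mul_nonneg hη (hg i))) hq.le
    linarith
  linarith

theorem potential_le {k : ℕ} (hk : 1 ≤ k) {S U : Finset (Fin N)} {w : Fin N → ℝ}
    (hw : ∀ i, 0 < w i) (hU : U ⊆ S) (hcard : #U = min k #S) :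
    potential k S w ≤ -∑ i ∈ U, Real.log (w i) := by
  have h1 := potential_add_le hk S hw (u := fun i => if i ∈ U then 1 else 0)
    (fun i _ => by split_ifs <;> norm_num) (by
      rw [← hcard, Finset.sum_ite_mem, Finset.inter_eq_right.2 hU]; simp)
  have h2 : ∑ i ∈ S, (if i ∈ U then (1 : ℝ) else 0) *
      (Real.log (if i ∈ U then (1 : ℝ) else 0) - Real.log (w i)) =
      -∑ i ∈ U, Real.log (w i) := by
    rw [← Finset.sum_neg_distrib]
    refine Eq.trans (Finset.sum_subset hU fun i _ hi => by simp [hi]).symm ?_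
    exact Finset.sum_congr rfl fun i hi => by simp [hi]
  rw [h2] at h1
  refine le_trans (le_add_of_nonneg_right (Finset.sum_nonneg fun i hi => ?_)) h1
  have := sub_le_mul_log_sub_log (x := if i ∈ U then (1 : ℝ) else 0) (by split_ifs <;> norm_num)
    (scaledProb_pos hk hw hi)
  linarith

theorem le_potential_one {k : ℕ} (hk : 1 ≤ k) (hkN : k ≤ N) (S : Finset (Fin N)) :
    -(k * Real.log (N / k)) ≤ potential k S fun _ => 1 := by
  have hk0 : (0 : ℝ) < k := by exact_mod_cast hk
  have hkN' : (k : ℝ) ≤ N := by exact_mod_cast hkN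
  have hN0 : (0 : ℝ) < N := hk0.trans_le hkN'
  have hw : ∀ _ : Fin N, (0 : ℝ) < 1 := fun _ => one_pos
  have hlog : 0 ≤ Real.log (N / k) := Real.log_nonneg ((one_le_div hk0).2 hkN')
  set q := scaledProb k S (fun _ => 1) with hq
  rcases le_or_gt #S k with hS | hS
  · have : potential k S (fun _ => 1) = 0 := by
      refine Finset.sum_eq_zero fun i hi => ?_
      rw [scaledProb_of_card_le hk hS hw, if_pos hi]; simp
    rw [this, neg_nonpos]
    positivity
  · have hS0 : (0 : ℝ) < #S := by exact_mod_cast (by omega : 0 < #S)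
    have hsum := sum_scaledProb hk S hw
    rw [min_eq_left hS.le, ← hq] at hsum
    -- With unit weights the potential is `∑ q log q`, which is smallest when the mass `k` is spread
    -- evenly over `S`.
    have h1 : ∑ i ∈ S, (q i - k / #S) ≤
        ∑ i ∈ S, q i * (Real.log (q i) - Real.log (k / #S)) :=
      Finset.sum_le_sum fun i _ =>
        sub_le_mul_log_sub_log (scaledProb_mem_Icc hk S hw i).1 (by positivity)
    have h2 : ∑ i ∈ S, (q i - k / #S) = 0 := by
      rw [Finset.sum_sub_distrib, hsum, Finset.sum_const, nsmul_eq_mul]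
      field_simp
      simp
    have h3 : ∑ i ∈ S, q i * (Real.log (q i) - Real.log (k / #S)) =
        potential k S (fun _ => 1) - k * Real.log (k / #S) := by
      simp only [potential, ← hq, Real.log_one, sub_zero, mul_sub, Finset.sum_sub_distrib]
      rw [← Finset.sum_mul, hsum]
    have h4 : Real.log (k / #S) = -Real.log (#S / k) := by rw [← Real.log_inv, inv_div]
    have h5 : Real.log (#S / k) ≤ Real.log (N / k) := by
      refine Real.log_le_log (by positivity) (div_le_div_of_nonneg_right ?_ hk0.le)
      exact_mod_cast (Finset.card_le_univ S).trans (by simp)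
    have h6 := mul_le_mul_of_nonneg_left h5 hk0.le
    rw [h2, h3, h4] at h1
    linarith

end Potential

/-! ### Expectations of finitely supported laws -/

section Expect

variable {α β : Type}

/-- The expectation of `f` under the law `p`, as a sum. -/
def expect (p : PMF α) (f : α → ℝ) : ℝ := ∑' x, (p x).toReal * f x

theorem expect_eq_sum {p : PMF α} {s : Finset α} (hs : p.support ⊆ s) (f : α → ℝ) :
    expect p f = ∑ x ∈ s, (p x).toReal * f x := by
  refine tsum_eq_sum fun x hx => ?_
  have : p x = 0 := by
    by_contra h
    exact hx (hs ((p.mem_support_iff x).2 h))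
  simp [this]

theorem expect_eq_sum_toFinset {p : PMF α} (hp : p.support.Finite) (f : α → ℝ) :
    expect p f = ∑ x ∈ hp.toFinset, (p x).toReal * f x :=
  expect_eq_sum (by simp) f

theorem expect_fintype [Fintype α] (p : PMF α) (f : α → ℝ) :
    expect p f = ∑ x, (p x).toReal * f x :=
  expect_eq_sum (by simp) f

theorem expect_const_mul (p : PMF α) (c : ℝ) (f : α → ℝ) :
    expect p (fun x => c * f x) = c * expect p f := by
  simp only [expect, mul_left_comm _ c, tsum_mul_left]

theorem expect_const (p : PMF α) (c : ℝ) : expect p (fun _ => c) = c := by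
  rw [expect, tsum_mul_right, ← ENNReal.tsum_toReal_eq (fun x => p.apply_ne_top x), p.tsum_coe]
  simp

theorem expect_add {p : PMF α} (hp : p.support.Finite) (f g : α → ℝ) :
    expect p (fun x => f x + g x) = expect p f + expect p g := by
  simp only [expect_eq_sum_toFinset hp, mul_add, Finset.sum_add_distrib]

theorem expect_sub {p : PMF α} (hp : p.support.Finite) (f g : α → ℝ) :
    expect p (fun x => f x - g x) = expect p f - expect p g := by
  simp only [expect_eq_sum_toFinset hp, mul_sub, Finset.sum_sub_distrib]

theorem expect_sum {ι : Type} {p : PMF α} (hp : p.support.Finite) (s : Finset ι)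
    (f : ι → α → ℝ) : expect p (fun x => ∑ i ∈ s, f i x) = ∑ i ∈ s, expect p (f i) := by
  simp only [expect_eq_sum_toFinset hp, Finset.mul_sum]
  exact Finset.sum_comm

theorem expect_mono {p : PMF α} (hp : p.support.Finite) {f g : α → ℝ}
    (h : ∀ x ∈ p.support, f x ≤ g x) : expect p f ≤ expect p g := by
  simp only [expect_eq_sum_toFinset hp]
  exact Finset.sum_le_sum fun x hx =>
    mul_le_mul_of_nonneg_left (h x (by simpa using hx)) ENNReal.toReal_nonneg

theorem expect_congr {p : PMF α} {f g : α → ℝ} (h : ∀ x ∈ p.support, f x = g x) :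
    expect p f = expect p g := by
  refine tsum_congr fun x => ?_
  by_cases hx : x ∈ p.support
  · rw [h x hx]
  · rw [p.mem_support_iff, not_not] at hx; simp [hx]

theorem expect_nonneg {p : PMF α} {f : α → ℝ} (h : ∀ x, 0 ≤ f x) : 0 ≤ expect p f :=
  tsum_nonneg fun x => mul_nonneg ENNReal.toReal_nonneg (h x)

theorem expect_pure (a : α) (f : α → ℝ) : expect (PMF.pure a) f = f a := by
  rw [expect_eq_sum (s := {a}) (by simp)]
  simp

/-- The states form an infinite type, but only finitely many are reachable in each round; this keeps
all expectations finite sums. -/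
theorem finite_support_bind {p : PMF α} {g : α → PMF β} (hp : p.support.Finite)
    (hg : ∀ a, (g a).support.Finite) : (p.bind g).support.Finite := by
  rw [PMF.support_bind]
  exact hp.biUnion fun a _ => hg a

theorem expect_bind {p : PMF α} {g : α → PMF β} (hp : p.support.Finite)
    (hg : ∀ a, (g a).support.Finite) (f : β → ℝ) :
    expect (p.bind g) f = expect p fun a => expect (g a) f := by
  have hb := finite_support_bind hp hg
  have h1 : ∀ a ∈ hp.toFinset,
      expect (g a) f = ∑ x ∈ hb.toFinset, (g a x).toReal * f x := fun a ha => by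
    refine expect_eq_sum (fun x hx => ?_) f
    rw [Set.Finite.coe_toFinset, PMF.mem_support_bind_iff]
    exact ⟨a, by simpa using ha, hx⟩
  have h2 : ∀ x, ((p.bind g) x).toReal = ∑ a ∈ hp.toFinset, (p a).toReal * (g a x).toReal := by
    intro x
    rw [PMF.bind_apply, tsum_eq_sum (s := hp.toFinset) (fun a ha => by
      have : p a = 0 := by simpa using ha
      simp [this]), ENNReal.toReal_sum fun a _ =>
        ENNReal.mul_ne_top (p.apply_ne_top a) ((g a).apply_ne_top x)]
    simp only [ENNReal.toReal_mul]
  rw [expect_eq_sum_toFinset hb, expect_eq_sum_toFinset hp]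
  simp only [h2, Finset.sum_mul]
  rw [Finset.sum_comm]
  refine Finset.sum_congr rfl fun a ha => ?_
  rw [h1 a ha, Finset.mul_sum]
  simp only [mul_assoc]

theorem expect_map {p : PMF α} (hp : p.support.Finite) (h : α → β) (f : β → ℝ) :
    expect (p.map h) f = expect p fun a => f (h a) := by
  rw [PMF.map, expect_bind hp fun a => by simp]
  simp only [Function.comp_apply, expect_pure]

theorem integral_toMeasure_eq_expect [MeasurableSpace α] [MeasurableSingletonClass α] {p : PMF α}
    (hp : p.support.Finite) (f : α → ℝ) : ∫ x, f x ∂p.toMeasure = expect p f := by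
  rw [PMF.integral_eq_tsum]
  · rfl
  · rw [← PMF.restrict_toMeasure_support]
    exact MeasureTheory.IntegrableOn.of_finite hp

end Expect

/-! ### Concentration -/

section Concentration

variable {α : Type}

/-- Hoeffding's lemma for a variable with values in `[0, 1]`. -/
theorem expect_exp_le [Fintype α] (p : PMF α) {f : α → ℝ} (hf : ∀ x, f x ∈ Set.Icc (0 : ℝ) 1)
    (s : ℝ) : expect p (fun x => Real.exp (s * (f x - expect p f))) ≤ Real.exp (s ^ 2 / 8) := by
  let _ : MeasurableSpace α := ⊤
  have h := (ProbabilityTheory.hasSubgaussianMGF_of_mem_Icc (μ := p.toMeasure) (X := f)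
    (a := 0) (b := 1) (measurable_from_top.aemeasurable) (.of_forall hf)).mgf_le s
  rw [ProbabilityTheory.mgf, integral_toMeasure_eq_expect (Set.toFinite _),
    integral_toMeasure_eq_expect (Set.toFinite _)] at h
  refine h.trans (Real.exp_le_exp.2 (le_of_eq ?_))
  simp
  ring

/-- The Chernoff bound for both tails of a centred variable with variance proxy `n / 4`. -/
theorem expect_tail_le {p : PMF α} (hp : p.support.Finite) {Y : α → ℝ} {n r : ℝ} (hn : 0 < n)
    (hr : 0 ≤ r) (hY : ∀ s, expect p (fun x => Real.exp (s * Y x)) ≤ Real.exp (n * s ^ 2 / 8)) :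
    expect p (fun x => if r < |Y x| then 1 else 0) ≤ 2 * Real.exp (-(2 * r ^ 2 / n)) := by
  -- The minimizer of the Chernoff exponent `-s r + n s² / 8`.
  set s := 4 * r / n with hs
  have hs0 : 0 ≤ s := by positivity
  have h1 : expect p (fun x => if r < |Y x| then 1 else 0) ≤ expect p fun x =>
      Real.exp (-(s * r)) * (Real.exp (s * Y x) + Real.exp (-s * Y x)) := by
    refine expect_mono hp fun x _ => ?_
    split_ifs with h
    · rw [mul_add, ← Real.exp_add, ← Real.exp_add]
      rcases abs_cases (Y x) with ⟨ha, _⟩ | ⟨ha, _⟩ <;> rw [ha] at h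
      · have : 1 ≤ Real.exp (-(s * r) + s * Y x) := Real.one_le_exp (by nlinarith)
        linarith [Real.exp_pos (-(s * r) + -s * Y x)]
      · have : 1 ≤ Real.exp (-(s * r) + -s * Y x) := Real.one_le_exp (by nlinarith)
        linarith [Real.exp_pos (-(s * r) + s * Y x)]
    · positivity
  rw [expect_const_mul, expect_add hp] at h1
  have h2 := hY s
  have h3 := hY (-s)
  rw [neg_sq] at h3
  have h4 : Real.exp (-(2 * r ^ 2 / n)) = Real.exp (-(s * r)) * Real.exp (n * s ^ 2 / 8) := by
    rw [← Real.exp_add, hs]; congr 1; field_simp; ring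
  rw [h4]
  have h5 := mul_le_mul_of_nonneg_left (add_le_add h2 h3) (Real.exp_pos (-(s * r))).le
  linarith

theorem expect_iidLaw_prod [Fintype α] [DecidableEq α] (n : ℕ) (p : PMF α) (g : α → ℝ) :
    expect (iidLaw n p) (fun x => ∏ τ, g (x τ)) = expect p g ^ n := by
  rw [expect_fintype, expect_fintype]
  simp only [iidLaw, PMF.ofFintype_apply, ENNReal.toReal_prod, ← Finset.prod_mul_distrib]
  rw [← Fintype.piFinset_univ, ← Finset.prod_univ_sum (fun _ => univ)
    (fun _ x => (p x).toReal * g x)]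
  simp

theorem expect_iidLaw_tail_le [Fintype α] [DecidableEq α] {n : ℕ} (hn : 1 ≤ n) (p : PMF α)
    {f : α → ℝ} (hf : ∀ x, f x ∈ Set.Icc (0 : ℝ) 1) {ε : ℝ} (hε : 0 ≤ ε) :
    expect (iidLaw n p)
      (fun x => if ε < |1 / (n : ℝ) * ∑ τ, f (x τ) - expect p f| then 1 else 0) ≤
      2 * Real.exp (-(2 * n * ε ^ 2)) := by
  have hn0 : (0 : ℝ) < n := by exact_mod_cast hn
  have h := expect_tail_le (p := iidLaw n p) (Set.toFinite _)
    (Y := fun x => ∑ τ, (f (x τ) - expect p f)) (n := n) (r := n * ε) hn0 (by positivity)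
    (fun s => by
      simp only [Finset.mul_sum, Real.exp_sum]
      rw [expect_iidLaw_prod n p fun x => Real.exp (s * (f x - expect p f)), mul_div_assoc,
        Real.exp_nat_mul]
      exact pow_le_pow_left₀ (expect_nonneg fun x => (Real.exp_pos _).le)
        (expect_exp_le p hf s) n)
  have h2 : 2 * (n * ε) ^ 2 / (n : ℝ) = 2 * n * ε ^ 2 := by field_simp
  rw [h2] at h
  refine le_of_eq_of_le (expect_congr fun x _ => ?_) h
  have h3 : ∑ τ, (f (x τ) - expect p f) = n * (1 / (n : ℝ) * ∑ τ, f (x τ) - expect p f) := by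
    rw [Finset.sum_sub_distrib]
    simp
    field_simp
  rw [h3, abs_mul, abs_of_pos hn0]
  simp [hn0]

end Concentration

/-! ### Product laws -/

section ProductLaw

variable {N : ℕ}

theorem availabilityLaw_toReal (a : Fin N → Set.Icc (0 : ℝ) 1) (S : Finset (Fin N)) :
    (availabilityLaw a S).toReal = ∏ i, if i ∈ S then (a i : ℝ) else 1 - (a i : ℝ) := by
  rw [availabilityLaw, PMF.ofFintype_apply, ENNReal.toReal_ofReal]
  refine Finset.prod_nonneg fun i _ => ?_
  split_ifs
  · exact (a i).2.1
  · linarith [(a i).2.2]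

theorem sum_powerset_prod_ite_eq_one (s : Finset (Fin N)) (a : Fin N → ℝ) :
    ∑ S ∈ s.powerset, ∏ i ∈ s, (if i ∈ S then a i else 1 - a i) = 1 := by
  induction s using Finset.induction_on with
  | empty => simp
  | insert j s hj ih =>
    rw [Finset.sum_powerset_insert hj, ← Finset.sum_add_distrib]
    refine Eq.trans ?_ ih
    refine Finset.sum_congr rfl fun S hS => ?_
    have hjS : j ∉ S := fun h => hj (Finset.mem_powerset.1 hS h)
    have h1 : ∏ i ∈ s, (if i ∈ insert j S then a i else 1 - a i) =
        ∏ i ∈ s, if i ∈ S then a i else 1 - a i :=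
      Finset.prod_congr rfl fun i hi => by
        have : i ≠ j := fun h => hj (h ▸ hi)
        simp [this]
    rw [Finset.prod_insert hj, Finset.prod_insert hj, h1]
    simp [hjS]
    ring

/-- The total variation distance of product laws is subadditive. -/
theorem sum_powerset_abs_prod_sub_le (s : Finset (Fin N)) {a b : Fin N → ℝ}
    (ha : ∀ i, a i ∈ Set.Icc (0 : ℝ) 1) (hb : ∀ i, b i ∈ Set.Icc (0 : ℝ) 1) :
    ∑ S ∈ s.powerset, |∏ i ∈ s, (if i ∈ S then a i else 1 - a i) -
      ∏ i ∈ s, (if i ∈ S then b i else 1 - b i)| ≤ 2 * ∑ i ∈ s, |a i - b i| := by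
  induction s using Finset.induction_on with
  | empty => simp
  | insert j s hj ih =>
    rw [Finset.sum_powerset_insert hj, ← Finset.sum_add_distrib, Finset.sum_insert hj]
    -- The sets without and with `j` are paired, and in each the factor of `j` is exchanged
    -- separately. The weights `1 - a j` and `a j` of the old difference add up to `1`, and `|a j -
    -- b j|` appears twice.
    have key : ∀ S ∈ s.powerset,
        |∏ i ∈ insert j s, (if i ∈ S then a i else 1 - a i) -
          ∏ i ∈ insert j s, (if i ∈ S then b i else 1 - b i)| +
        |∏ i ∈ insert j s, (if i ∈ insert j S then a i else 1 - a i) -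
          ∏ i ∈ insert j s, (if i ∈ insert j S then b i else 1 - b i)| ≤
        |∏ i ∈ s, (if i ∈ S then a i else 1 - a i) -
          ∏ i ∈ s, (if i ∈ S then b i else 1 - b i)| +
        2 * |a j - b j| * ∏ i ∈ s, (if i ∈ S then b i else 1 - b i) := by
      intro S hS
      have hjS : j ∉ S := fun h => hj (Finset.mem_powerset.1 hS h)
      have h1 : ∀ c : Fin N → ℝ, ∏ i ∈ s, (if i ∈ insert j S then c i else 1 - c i) =
          ∏ i ∈ s, if i ∈ S then c i else 1 - c i := fun c =>
        Finset.prod_congr rfl fun i hi => by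
          have : i ≠ j := fun h => hj (h ▸ hi)
          simp [this]
      have hB : 0 ≤ ∏ i ∈ s, (if i ∈ S then b i else 1 - b i) :=
        Finset.prod_nonneg fun i _ => by
          split_ifs
          · exact (hb i).1
          · linarith [(hb i).2]
      simp only [Finset.prod_insert hj, h1, hjS, if_false, Finset.mem_insert_self, if_true]
      set A := ∏ i ∈ s, (if i ∈ S then a i else 1 - a i)
      set B := ∏ i ∈ s, (if i ∈ S then b i else 1 - b i)
      have h2 : |(1 - a j) * A - (1 - b j) * B| ≤ (1 - a j) * |A - B| + |a j - b j| * B := by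
        have : (1 - a j) * A - (1 - b j) * B = (1 - a j) * (A - B) + (b j - a j) * B := by ring
        rw [this]
        refine (abs_add_le _ _).trans ?_
        rw [abs_mul, abs_mul, abs_of_nonneg hB, abs_sub_comm (b j),
          abs_of_nonneg (sub_nonneg.2 (ha j).2)]
      have h3 : |a j * A - b j * B| ≤ a j * |A - B| + |a j - b j| * B := by
        have : a j * A - b j * B = a j * (A - B) + (a j - b j) * B := by ring
        rw [this]
        refine (abs_add_le _ _).trans ?_
        rw [abs_mul, abs_mul, abs_of_nonneg hB, abs_of_nonneg (ha j).1]
      linarith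
    refine (Finset.sum_le_sum key).trans ?_
    rw [Finset.sum_add_distrib, ← Finset.mul_sum, sum_powerset_prod_ite_eq_one]
    linarith

theorem abs_expect_availabilityLaw_sub_le (a b : Fin N → Set.Icc (0 : ℝ) 1)
    {f : Finset (Fin N) → ℝ} (hf : ∀ S, f S ∈ Set.Icc (0 : ℝ) 1) :
    |expect (availabilityLaw a) f - expect (availabilityLaw b) f| ≤
      2 * ∑ i, |(a i : ℝ) - b i| := by
  rw [expect_fintype, expect_fintype, ← Finset.sum_sub_distrib]
  refine (Finset.abs_sum_le_sum_abs _ _).trans ?_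
  refine le_trans ?_ (sum_powerset_abs_prod_sub_le univ (fun i => (a i).2) (fun i => (b i).2))
  rw [Finset.powerset_univ]
  refine Finset.sum_le_sum fun S _ => ?_
  rw [availabilityLaw_toReal, availabilityLaw_toReal, ← sub_mul, abs_mul,
    abs_of_nonneg (hf S).1]
  exact mul_le_of_le_one_right (abs_nonneg _) (hf S).2

theorem expect_availabilityLaw_mem (a : Fin N → Set.Icc (0 : ℝ) 1) (i : Fin N) :
    expect (availabilityLaw a) (fun S => if i ∈ S then 1 else 0) = a i := by
  rw [expect_fintype]
  -- Setting the absence factor of `i` to zero retains exactly the sets that contain `i` in the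
  -- expansion of the product.
  have h := Finset.prod_add (fun j => (a j : ℝ)) (fun j => if j = i then 0 else 1 - (a j : ℝ)) univ
  have h1 : ∏ j, ((a j : ℝ) + if j = i then 0 else 1 - (a j : ℝ)) = a i := by
    rw [Finset.prod_eq_single i] <;> simp +contextual
  rw [← h1, h, Finset.powerset_univ]
  refine Finset.sum_congr rfl fun S _ => ?_
  rw [availabilityLaw_toReal]
  by_cases hi : i ∈ S
  · rw [if_pos hi, mul_one, Finset.prod_ite, Finset.filter_mem_eq_inter, Finset.univ_inter,
      Finset.filter_notMem_eq_sdiff]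
    congr 1
    refine Finset.prod_congr rfl fun j hj => ?_
    rw [if_neg]
    rintro rfl
    exact (Finset.mem_sdiff.1 hj).2 hi
  · have h2 : ∏ j ∈ univ \ S, (if j = i then 0 else 1 - (a j : ℝ)) = 0 :=
      Finset.prod_eq_zero (Finset.mem_sdiff.2 ⟨Finset.mem_univ i, hi⟩) (if_pos rfl)
    rw [if_neg hi, mul_zero, h2, mul_zero]

end ProductLaw

/-! ### The estimate of a single loss -/

section Estimate

variable {α : Type} [Fintype α] {p : PMF α} {I : α → Prop} [DecidablePred I] {r : α → ℝ}
  {l lam q B : ℝ}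

/-- Here `I` is the event that the arm is played, `r` the estimate of its probability `q`, and `B`
the probability of a miss; `r` and `I` may be dependent. Off the miss event `r + lam ≤ q + 2 * lam`,
so the estimated loss is at least `l / (q + 2 * lam)` when the arm is played. -/
theorem le_mul_expect_estimate (hr : ∀ x, 0 ≤ r x) (hl : l ∈ Set.Icc (0 : ℝ) 1) (hlam : 0 < lam)
    (hq : expect p (fun x => if I x then 1 else 0) = q)
    (hB : expect p (fun x => if lam < |r x - q| then 1 else 0) = B) :
    q * l - 2 * lam - B ≤ q * expect p (fun x => if I x then l / (r x + lam) else 0) := by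
  have hq0 : 0 ≤ q := hq ▸ expect_nonneg fun x => by split_ifs <;> norm_num
  have hB0 : 0 ≤ B := hB ▸ expect_nonneg fun x => by split_ifs <;> norm_num
  have h1 : expect p (fun x => l * ((if I x then 1 else 0) - if lam < |r x - q| then 1 else 0)) ≤
      expect p fun x => (q + 2 * lam) * if I x then l / (r x + lam) else 0 := by
    refine expect_mono (Set.toFinite _) fun x _ => ?_
    have hd : 0 < r x + lam := by linarith [hr x]
    have he : 0 ≤ l / (r x + lam) := div_nonneg hl.1 hd.le
    split_ifs with h h' h'
    · simp only [sub_self, mul_zero]; positivity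
    · have h2 := (abs_le.1 (not_lt.1 h')).2
      rw [sub_zero, mul_one, mul_div_assoc', le_div_iff₀ hd]
      nlinarith [hl.1]
    · linarith [hl.1]
    · simp
  rw [expect_const_mul, expect_const_mul, expect_sub (Set.toFinite _), hq, hB] at h1
  set E := expect p (fun x => if I x then l / (r x + lam) else 0)
  -- After clearing this denominator, the slack in the claim is `(1 - l) * q * (2 * lam + B) + 4 *
  -- lam ^ 2 + 2 * lam * B`.
  have hpos : 0 < q + 2 * lam := by linarith
  refine le_of_mul_le_mul_right ?_ hpos
  have h2 := mul_le_mul_of_nonneg_left h1 hq0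
  have h3 : 0 ≤ (1 - l) * (2 * lam * q) := mul_nonneg (by linarith [hl.2]) (by positivity)
  have h4 : 0 ≤ (1 - l) * (q * B) := mul_nonneg (by linarith [hl.2]) (by positivity)
  have h5 : 0 ≤ lam * B := by positivity
  nlinarith [sq_nonneg lam]

/-- Adding `lam` makes the estimate optimistic: off the miss event `r + lam ≥ q`, so the value is at
most `l / q` and `q` cancels against the probability of `I`. On the miss event the value is at most
`1 / lam`. -/
theorem expect_estimate_le (hr : ∀ x, 0 ≤ r x) (hl : l ∈ Set.Icc (0 : ℝ) 1) (hlam : 0 < lam)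
    (hq : expect p (fun x => if I x then 1 else 0) = q)
    (hB : expect p (fun x => if lam < |r x - q| then 1 else 0) = B) :
    expect p (fun x => if I x then l / (r x + lam) else 0) ≤ l + B / lam := by
  have hq0 : 0 ≤ q := hq ▸ expect_nonneg fun x => by split_ifs <;> norm_num
  have hB0 : 0 ≤ B := hB ▸ expect_nonneg fun x => by split_ifs <;> norm_num
  have hle : ∀ x, l / (r x + lam) ≤ 1 / lam := fun x =>
    div_le_div₀ zero_le_one hl.2 hlam (by linarith [hr x])
  rcases hq0.eq_or_lt with h0 | hpos
  · have h1 : expect p (fun x => if I x then l / (r x + lam) else 0) ≤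
        expect p fun x => 1 / lam * if I x then 1 else 0 := by
      refine expect_mono (Set.toFinite _) fun x _ => ?_
      split_ifs
      · simpa using hle x
      · simp
    rw [expect_const_mul, hq, ← h0, mul_zero] at h1
    exact h1.trans (add_nonneg hl.1 (by positivity))
  · have h1 : expect p (fun x => q * if I x then l / (r x + lam) else 0) ≤
        expect p fun x => l * (if I x then 1 else 0) +
          q / lam * if lam < |r x - q| then 1 else 0 := by
      refine expect_mono (Set.toFinite _) fun x _ => ?_
      have hd : 0 < r x + lam := by linarith [hr x]
      split_ifs with h h' h'
      · have := mul_le_mul_of_nonneg_left (hle x) hq0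
        rw [mul_one_div] at this
        linarith [hl.1]
      · have h2 := (abs_le.1 (not_lt.1 h')).1
        rw [mul_zero, add_zero, mul_one, mul_div_assoc', div_le_iff₀ hd]
        nlinarith [hl.1]
      · simp; positivity
      · simp
    rw [expect_const_mul, expect_add (Set.toFinite _), expect_const_mul, expect_const_mul, hq,
      hB] at h1
    refine le_of_mul_le_mul_left (h1.trans (le_of_eq ?_)) hpos
    ring

/-- The same splitting for squares: one factor `q` cancels against the probability of `I`, the other
is the weight in front. -/
theorem mul_expect_estimate_sq_le (hr : ∀ x, 0 ≤ r x) (hl : l ∈ Set.Icc (0 : ℝ) 1)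
    (hlam : 0 < lam) (hq : expect p (fun x => if I x then 1 else 0) = q) (hq1 : q ≤ 1)
    (hB : expect p (fun x => if lam < |r x - q| then 1 else 0) = B) :
    q * expect p (fun x => (if I x then l / (r x + lam) else 0) ^ 2) ≤ 1 + B / lam ^ 2 := by
  have hq0 : 0 ≤ q := hq ▸ expect_nonneg fun x => by split_ifs <;> norm_num
  have hB0 : 0 ≤ B := hB ▸ expect_nonneg fun x => by split_ifs <;> norm_num
  have hB' : 0 ≤ B / lam ^ 2 := by positivity
  rcases hq0.eq_or_lt with h0 | hpos
  · rw [← h0, zero_mul]; linarith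
  · have h1 : expect p (fun x => q ^ 2 * (if I x then l / (r x + lam) else 0) ^ 2) ≤
        expect p fun x => (if I x then 1 else 0) +
          q ^ 2 / lam ^ 2 * if lam < |r x - q| then 1 else 0 := by
      refine expect_mono (Set.toFinite _) fun x _ => ?_
      have hd : 0 < r x + lam := by linarith [hr x]
      have hl2 : l ^ 2 ≤ 1 := pow_le_one₀ hl.1 hl.2
      split_ifs with h h' h'
      · have h2 : (l / (r x + lam)) ^ 2 ≤ 1 / lam ^ 2 := by
          rw [div_pow]
          exact div_le_div₀ zero_le_one hl2 (by positivity)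
            (pow_le_pow_left₀ hlam.le (by linarith [hr x]) 2)
        have := mul_le_mul_of_nonneg_left h2 (sq_nonneg q)
        rw [mul_one_div] at this
        linarith
      · have h2 := (abs_le.1 (not_lt.1 h')).1
        have h3 : q ^ 2 ≤ (r x + lam) ^ 2 := pow_le_pow_left₀ hq0 (by linarith) 2
        rw [mul_zero, add_zero, div_pow, mul_div_assoc', div_le_one (by positivity)]
        nlinarith [sq_nonneg l, sq_nonneg q]
      · simp; positivity
      · simp
    rw [expect_const_mul, expect_add (Set.toFinite _), expect_const_mul, hq, hB] at h1
    have h2 : q * (q * expect p (fun x => (if I x then l / (r x + lam) else 0) ^ 2)) ≤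
        q * (1 + q * (B / lam ^ 2)) := by
      refine le_trans (le_of_eq (by ring)) (h1.trans (le_of_eq (by ring)))
    have h3 := le_of_mul_le_mul_left h2 hpos
    nlinarith

end Estimate

/-! ### One round -/

section Round

variable {N k : ℕ} {rule : (Fin N → ℝ) → PMF (Finset (Fin N))} {a : Fin N → Set.Icc (0 : ℝ) 1}
  {ℓ : ℕ → Fin N → ℝ} {lam : ℕ → ℝ} {η : ℝ} {t : ℕ} {st : State N}

/-- The joint law of the available set, the played set and the Monte Carlo sets in round `t`. -/
def draw (k : ℕ) (rule : (Fin N → ℝ) → PMF (Finset (Fin N))) (a : Fin N → Set.Icc (0 : ℝ) 1)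
    (t : ℕ) (st : State N) :
    PMF (Finset (Fin N) × Finset (Fin N) × (Fin t → Finset (Fin N))) :=
  (availabilityLaw a).bind fun S =>
  (playLaw k rule S st.weight).bind fun Ω =>
  (iidLaw t (availabilityLaw (empiricalFreq (Function.update st.avail t S) t))).map fun x =>
    (S, Ω, x)

/-- The state after round `t` as a function of the random sets drawn in this round. -/
def nextState (k : ℕ) (ℓ : ℕ → Fin N → ℝ) (lam : ℕ → ℝ) (η : ℝ) (t : ℕ) (st : State N)
    (ω : Finset (Fin N) × Finset (Fin N) × (Fin t → Finset (Fin N))) : State N where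
  weight := fun i => st.weight i *
    Real.exp (-η * lossEstimate ω.2.1 (ℓ t) (monteCarlo k t st.weight ω.2.2) (lam t) i)
  avail := Function.update st.avail t ω.1
  play := Function.update st.play t ω.2.1

theorem round_eq_map (st : State N) :
    round k rule a ℓ lam η t st = (draw k rule a t st).map (nextState k ℓ lam η t st) := by
  simp only [round, draw, PMF.map, PMF.bind_bind, PMF.pure_bind, Function.comp_def, nextState]

theorem expect_draw (f : Finset (Fin N) × Finset (Fin N) × (Fin t → Finset (Fin N)) → ℝ) :
    expect (draw k rule a t st) f = expect (availabilityLaw a) fun S =>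
      expect (playLaw k rule S st.weight) fun Ω =>
      expect (iidLaw t (availabilityLaw (empiricalFreq (Function.update st.avail t S) t))) fun x =>
        f (S, Ω, x) := by
  rw [draw, expect_bind (Set.toFinite _) fun _ => Set.toFinite _]
  refine expect_congr fun S _ => ?_
  rw [expect_bind (Set.toFinite _) fun _ => Set.toFinite _]
  refine expect_congr fun Ω _ => ?_
  rw [expect_map (Set.toFinite _)]

theorem expect_draw_avail (f : Finset (Fin N) → ℝ) :
    expect (draw k rule a t st) (fun ω => f ω.1) = expect (availabilityLaw a) f := by
  rw [expect_draw]
  refine expect_congr fun S _ => ?_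
  rw [expect_congr fun Ω _ => expect_const _ (f S), expect_const]

theorem expect_draw_play (f : Finset (Fin N) → ℝ) :
    expect (draw k rule a t st) (fun ω => f ω.2.1) =
      expect (availabilityLaw a) fun S => expect (playLaw k rule S st.weight) f := by
  rw [expect_draw]
  exact expect_congr fun S _ => expect_congr fun Ω _ => expect_const _ (f Ω)

theorem finite_support_round (st : State N) :
    (round k rule a ℓ lam η t st).support.Finite := by
  rw [round_eq_map, PMF.support_map]
  exact (Set.toFinite _).image _

theorem expect_round (st : State N) (f : State N → ℝ) :
    expect (round k rule a ℓ lam η t st) f =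
      expect (draw k rule a t st) fun ω => f (nextState k ℓ lam η t st ω) := by
  rw [round_eq_map, expect_map (Set.toFinite _)]

/-- The probability that arm `i` is played, given the weights. -/
def playProb (k : ℕ) (a : Fin N → Set.Icc (0 : ℝ) 1) (w : Fin N → ℝ) (i : Fin N) : ℝ :=
  expect (availabilityLaw a) fun S => scaledProb k S w i

/-- The probability that the policy `π` plays arm `i`. -/
def policyProb (a : Fin N → Set.Icc (0 : ℝ) 1) (π : Policy N k) (i : Fin N) : ℝ :=
  expect (availabilityLaw a) fun S => if i ∈ π.1 S then 1 else 0

/-- The expected potential, relative to the log-weights of the arms that the policy `π` plays. -/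
def policyPotential (a : Fin N → Set.Icc (0 : ℝ) 1) (π : Policy N k) (w : Fin N → ℝ) : ℝ :=
  expect (availabilityLaw a) fun S => potential k S w + ∑ i ∈ π.1 S, Real.log (w i)

theorem expect_mem_Icc {α : Type} {p : PMF α} (hp : p.support.Finite) {f : α → ℝ}
    (hf : ∀ x, f x ∈ Set.Icc (0 : ℝ) 1) : expect p f ∈ Set.Icc (0 : ℝ) 1 :=
  ⟨expect_nonneg fun x => (hf x).1,
    (expect_mono hp fun x _ => (hf x).2).trans (expect_const p 1).le⟩

theorem playProb_mem_Icc (hk : 1 ≤ k) {w : Fin N → ℝ} (hw : ∀ i, 0 < w i) (i : Fin N) :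
    playProb k a w i ∈ Set.Icc (0 : ℝ) 1 :=
  expect_mem_Icc (Set.toFinite _) fun S => scaledProb_mem_Icc hk S hw i

theorem policyProb_mem_Icc (π : Policy N k) (i : Fin N) :
    policyProb a π i ∈ Set.Icc (0 : ℝ) 1 :=
  expect_mem_Icc (Set.toFinite _) fun S => by split_ifs <;> simp

/-- The decomposition rule enters only here, through its marginals; how it correlates the arms is
irrelevant. -/
theorem expect_playLaw_mem (hk : 1 ≤ k)
    (hrule : ∀ p, IsScaledCapped k p → IsMixture k p (rule p)) (S : Finset (Fin N))
    {w : Fin N → ℝ} (hw : ∀ i, 0 < w i) (i : Fin N) :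
    expect (playLaw k rule S w) (fun Ω => if i ∈ Ω then 1 else 0) = scaledProb k S w i := by
  rw [playLaw]
  split_ifs with hS
  · rw [expect_fintype]
    exact (hrule _ (isScaledCapped_scaledProb hk hS hw)).2 i
  · rw [expect_pure, scaledProb_of_card_le hk (by omega) hw]

theorem expect_draw_mem (hk : 1 ≤ k) (hrule : ∀ p, IsScaledCapped k p → IsMixture k p (rule p))
    (hw : ∀ i, 0 < st.weight i) (i : Fin N) :
    expect (draw k rule a t st) (fun ω => if i ∈ ω.2.1 then 1 else 0) =
      playProb k a st.weight i := by
  rw [expect_draw_play fun Ω => if i ∈ Ω then 1 else 0]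
  exact expect_congr fun S _ => expect_playLaw_mem hk hrule S hw i

theorem expect_draw_regret (hk : 1 ≤ k)
    (hrule : ∀ p, IsScaledCapped k p → IsMixture k p (rule p))
    (hw : ∀ i, 0 < st.weight i) (π : Policy N k) (l : Fin N → ℝ) :
    expect (draw k rule a t st) (fun ω => ∑ i ∈ ω.2.1, l i - ∑ i ∈ π.1 ω.1, l i) =
      ∑ i, (playProb k a st.weight i - policyProb a π i) * l i := by
  have h1 : ∀ U : Finset (Fin N), ∑ i ∈ U, l i = ∑ i, l i * if i ∈ U then 1 else 0 := by simp
  have h2 : ∀ i, expect (draw k rule a t st) (fun ω => if i ∈ π.1 ω.1 then 1 else 0) =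
      policyProb a π i := fun i => expect_draw_avail fun S => if i ∈ π.1 S then 1 else 0
  simp only [h1]
  rw [expect_sub (Set.toFinite _), expect_sum (Set.toFinite _), expect_sum (Set.toFinite _),
    ← Finset.sum_sub_distrib]
  refine Finset.sum_congr rfl fun i _ => ?_
  rw [expect_const_mul, expect_const_mul, expect_draw_mem hk hrule hw, h2]
  ring

theorem policyPotential_nonpos (hk : 1 ≤ k) (π : Policy N k) {w : Fin N → ℝ}
    (hw : ∀ i, 0 < w i) : policyPotential a π w ≤ 0 := by
  rw [← expect_const (availabilityLaw a) 0]
  refine expect_mono (Set.toFinite _) fun S _ => ?_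
  linarith [potential_le hk hw (π.2 S).1 (π.2 S).2]

theorem le_policyPotential_one (hk : 1 ≤ k) (hkN : k ≤ N) (π : Policy N k) :
    -(k * Real.log (N / k)) ≤ policyPotential a π fun _ => 1 := by
  rw [← expect_const (availabilityLaw a) (-(k * Real.log (N / k)))]
  refine expect_mono (Set.toFinite _) fun S _ => ?_
  simpa using le_potential_one hk hkN S

/-- This is `potential_update_le` averaged over a fresh `S` with `g` held fixed. It is the reason
for dividing losses by an estimate of the averaged `playProb` rather than by `q^S` for the realized
set. -/
theorem policyPotential_update_le (hk : 1 ≤ k) (π : Policy N k) {w g : Fin N → ℝ}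
    (hw : ∀ i, 0 < w i) (hη : 0 ≤ η) (hg : ∀ i, 0 ≤ g i) :
    policyPotential a π w + ∑ i, (playProb k a w i * (η * g i - (η * g i) ^ 2) -
      policyProb a π i * (η * g i)) ≤
      policyPotential a π fun i => w i * Real.exp (-η * g i) := by
  have h1 : ∑ i, (playProb k a w i * (η * g i - (η * g i) ^ 2) - policyProb a π i * (η * g i)) =
      expect (availabilityLaw a) fun S => ∑ i, ((η * g i - (η * g i) ^ 2) * scaledProb k S w i -
        η * g i * if i ∈ π.1 S then 1 else 0) := by
    rw [expect_sum (Set.toFinite _)]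
    refine Finset.sum_congr rfl fun i _ => ?_
    rw [expect_sub (Set.toFinite _), expect_const_mul, expect_const_mul, playProb, policyProb]
    ring
  rw [h1, policyPotential, ← expect_add (Set.toFinite _)]
  refine expect_mono (Set.toFinite _) fun S _ => ?_
  have h2 := potential_update_le hk S hw hη hg
  have h3 : ∑ i ∈ π.1 S, Real.log (w i * Real.exp (-η * g i)) =
      ∑ i ∈ π.1 S, Real.log (w i) - ∑ i, η * g i * if i ∈ π.1 S then 1 else 0 := by
    have : ∑ i, (η * g i * if i ∈ π.1 S then 1 else 0) = ∑ i ∈ π.1 S, η * g i := by simp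
    rw [this, ← Finset.sum_sub_distrib]
    refine Finset.sum_congr rfl fun i _ => ?_
    rw [Real.log_mul (hw i).ne' (Real.exp_pos _).ne', Real.log_exp]
    ring
  have h4 : ∑ i, (η * g i - (η * g i) ^ 2) * scaledProb k S w i =
      ∑ i ∈ S, scaledProb k S w i * (η * g i - (η * g i) ^ 2) := by
    rw [← Finset.sum_subset (Finset.subset_univ S) fun i _ h => by
      rw [scaledProb_of_notMem h, mul_zero]]
    exact Finset.sum_congr rfl fun i _ => mul_comm _ _
  rw [Finset.sum_sub_distrib, h3, h4]
  linarith

theorem monteCarlo_mem_Icc (hk : 1 ≤ k) {w : Fin N → ℝ} (hw : ∀ i, 0 < w i)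
    (x : Fin t → Finset (Fin N)) (i : Fin N) : monteCarlo k t w x i ∈ Set.Icc (0 : ℝ) 1 := by
  rw [monteCarlo, one_div_mul_eq_div]
  refine ⟨div_nonneg (Finset.sum_nonneg fun τ _ => (scaledProb_mem_Icc hk _ hw i).1) (by positivity),
    div_le_one_of_le₀ ?_ (by positivity)⟩
  exact (Finset.sum_le_card_nsmul _ _ 1 fun τ _ => (scaledProb_mem_Icc hk _ hw i).2).trans
    (by simp)

/-- The probability that the Monte Carlo estimate for arm `i` is off by more than `lam`. -/
def missProb (k : ℕ) (rule : (Fin N → ℝ) → PMF (Finset (Fin N))) (a : Fin N → Set.Icc (0 : ℝ) 1)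
    (t : ℕ) (lam : ℝ) (i : Fin N) (st : State N) : ℝ :=
  expect (draw k rule a t st) fun ω =>
    if lam < |monteCarlo k t st.weight ω.2.2 i - playProb k a st.weight i| then 1 else 0

/-- The potential inequality is averaged over the round. The three moment bounds treat, arm by arm,
the linear term of the algorithm from below, the linear term of the policy from above, and the
quadratic term. -/
theorem expect_draw_regret_le (hk : 1 ≤ k)
    (hrule : ∀ p, IsScaledCapped k p → IsMixture k p (rule p))
    (hw : ∀ i, 0 < st.weight i) (π : Policy N k) (hℓ : ∀ i, ℓ t i ∈ Set.Icc (0 : ℝ) 1)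
    (hlam : 0 < lam t) (hη : 0 ≤ η) :
    η * expect (draw k rule a t st) (fun ω => ∑ i ∈ ω.2.1, ℓ t i - ∑ i ∈ π.1 ω.1, ℓ t i) +
      policyPotential a π st.weight ≤
    expect (draw k rule a t st)
      (fun ω => policyPotential a π (nextState k ℓ lam η t st ω).weight) +
    ∑ i, (η * (2 * lam t + (1 + 1 / lam t) * missProb k rule a t (lam t) i st) +
      η ^ 2 * (1 + 1 / lam t ^ 2 * missProb k rule a t (lam t) i st)) := by
  set D := draw k rule a t st with hD
  set g := fun ω : Finset (Fin N) × Finset (Fin N) × (Fin t → Finset (Fin N)) =>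
    lossEstimate ω.2.1 (ℓ t) (monteCarlo k t st.weight ω.2.2) (lam t) with hg
  have hmc := fun (x : Fin t → Finset (Fin N)) i => (monteCarlo_mem_Icc hk hw x i).1
  have hg0 : ∀ ω i, 0 ≤ g ω i := fun ω i => by
    simp only [hg, lossEstimate]
    split_ifs
    · exact div_nonneg (hℓ i).1 (by linarith [hmc ω.2.2 i])
    · exact le_rfl
  have h1 : expect D (fun ω => policyPotential a π st.weight +
      ∑ i, (playProb k a st.weight i * (η * g ω i - (η * g ω i) ^ 2) -
        policyProb a π i * (η * g ω i))) ≤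
      expect D (fun ω => policyPotential a π (nextState k ℓ lam η t st ω).weight) :=
    expect_mono (Set.toFinite _) fun ω _ => policyPotential_update_le hk π hw hη (hg0 ω)
  rw [expect_add (Set.toFinite _), expect_const, expect_sum (Set.toFinite _)] at h1
  rw [expect_draw_regret hk hrule hw]
  have h2 : η * ∑ i, (playProb k a st.weight i - policyProb a π i) * ℓ t i ≤
      ∑ i, expect D (fun ω => playProb k a st.weight i * (η * g ω i - (η * g ω i) ^ 2) -
        policyProb a π i * (η * g ω i)) +
      ∑ i, (η * (2 * lam t + (1 + 1 / lam t) * missProb k rule a t (lam t) i st) +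
      η ^ 2 * (1 + 1 / lam t ^ 2 * missProb k rule a t (lam t) i st)) := by
    rw [Finset.mul_sum, ← Finset.sum_add_distrib]
    refine Finset.sum_le_sum fun i _ => ?_
    have hq := expect_draw_mem (t := t) (a := a) hk hrule hw i
    have e1 := le_mul_expect_estimate (p := D) (B := missProb k rule a t (lam t) i st)
      (fun ω => hmc ω.2.2 i) (hℓ i) hlam hq rfl
    have e2 := expect_estimate_le (p := D) (B := missProb k rule a t (lam t) i st)
      (fun ω => hmc ω.2.2 i) (hℓ i) hlam hq rfl
    have e3 := mul_expect_estimate_sq_le (p := D) (B := missProb k rule a t (lam t) i st)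
      (fun ω => hmc ω.2.2 i) (hℓ i) hlam hq (playProb_mem_Icc hk hw i).2 rfl
    change _ ≤ _ * expect D (fun ω => g ω i) at e1
    change expect D (fun ω => g ω i) ≤ _ at e2
    change _ * expect D (fun ω => g ω i ^ 2) ≤ _ at e3
    have e4 : expect D (fun ω => playProb k a st.weight i * (η * g ω i - (η * g ω i) ^ 2) -
        policyProb a π i * (η * g ω i)) =
        η * (playProb k a st.weight i * expect D (fun ω => g ω i)) -
        η ^ 2 * (playProb k a st.weight i * expect D (fun ω => g ω i ^ 2)) -
        η * (policyProb a π i * expect D (fun ω => g ω i)) := by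
      rw [← expect_const_mul D (playProb k a st.weight i), ← expect_const_mul D η,
        ← expect_const_mul D (playProb k a st.weight i), ← expect_const_mul D (η ^ 2),
        ← expect_const_mul D (policyProb a π i), ← expect_const_mul D η,
        ← expect_sub (Set.toFinite _), ← expect_sub (Set.toFinite _)]
      exact expect_congr fun ω _ => by ring
    obtain ⟨hπ0, hπ1⟩ := policyProb_mem_Icc (a := a) π i
    have hB : 0 ≤ missProb k rule a t (lam t) i st :=
      expect_nonneg fun x => by split_ifs <;> norm_num
    have hBl : 0 ≤ missProb k rule a t (lam t) i st / lam t := by positivity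
    have e5 := mul_le_mul_of_nonneg_left e2 hπ0
    have e6 := mul_le_mul_of_nonneg_right hπ1 hBl
    have e7 := mul_le_mul_of_nonneg_left e3 (sq_nonneg η)
    have e8 : (playProb k a st.weight i - policyProb a π i) * ℓ t i ≤
        playProb k a st.weight i * expect D (fun ω => g ω i) -
        policyProb a π i * expect D (fun ω => g ω i) +
        (2 * lam t + (1 + 1 / lam t) * missProb k rule a t (lam t) i st) := by
      have : (1 + 1 / lam t) * missProb k rule a t (lam t) i st =
        missProb k rule a t (lam t) i st + missProb k rule a t (lam t) i st / lam t := by ring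
      rw [this]
      linarith
    have e9 := mul_le_mul_of_nonneg_left e8 hη
    have e10 : missProb k rule a t (lam t) i st / lam t ^ 2 =
      1 / lam t ^ 2 * missProb k rule a t (lam t) i st := by ring
    rw [e10] at e7
    rw [e4]
    linarith
  linarith

end Round

/-! ### The whole run -/

section Run

variable {N k : ℕ} {rule : (Fin N → ℝ) → PMF (Finset (Fin N))} {a : Fin N → Set.Icc (0 : ℝ) 1}
  {ℓ : ℕ → Fin N → ℝ} {lam : ℕ → ℝ} {η : ℝ}

theorem finite_support_run (t : ℕ) : (run k rule a ℓ lam η t).support.Finite := by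
  induction t with
  | zero => simp [run]
  | succ t ih => exact finite_support_bind ih fun st => finite_support_round st

theorem weight_pos_of_mem_support_run {t : ℕ} {st : State N}
    (h : st ∈ (run k rule a ℓ lam η t).support) (i : Fin N) : 0 < st.weight i := by
  induction t generalizing st with
  | zero =>
    rw [run, PMF.support_pure, Set.mem_singleton_iff] at h
    rw [h]
    exact one_pos
  | succ t ih =>
    rw [run, PMF.mem_support_bind_iff] at h
    obtain ⟨st', h', h⟩ := h
    rw [round_eq_map, PMF.support_map] at h
    obtain ⟨ω, -, rfl⟩ := h
    exact mul_pos (ih h') (Real.exp_pos _)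

theorem expect_run_succ (t : ℕ) (f : State N → ℝ) :
    expect (run k rule a ℓ lam η (t + 1)) f = expect (run k rule a ℓ lam η t) fun st =>
      expect (draw k rule a (t + 1) st) fun ω => f (nextState k ℓ lam η (t + 1) st ω) := by
  rw [run, expect_bind (finite_support_run t) fun st => finite_support_round st]
  exact expect_congr fun st _ => expect_round st f

/-- Given the past state, the next available set is a fresh draw from `P_a`, so each round
multiplies the moment generating function by at most `exp (s² / 8)`. -/
theorem expect_run_exp_avail_le (i : Fin N) (s : ℝ) (t : ℕ) :
    expect (run k rule a ℓ lam η t) (fun st => Real.exp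
      (s * ∑ j ∈ Icc 1 t, ((if i ∈ st.avail j then 1 else 0) - (a i : ℝ)))) ≤
      Real.exp (t * s ^ 2 / 8) := by
  induction t with
  | zero => simp [expect_const]
  | succ t ih =>
    have h1 : ∀ st : State N, expect (draw k rule a (t + 1) st) (fun ω => Real.exp (s *
        ∑ j ∈ Icc 1 (t + 1), ((if i ∈ (nextState k ℓ lam η (t + 1) st ω).avail j then 1 else 0) -
          (a i : ℝ)))) ≤ Real.exp (s ^ 2 / 8) * Real.exp
        (s * ∑ j ∈ Icc 1 t, ((if i ∈ st.avail j then 1 else 0) - (a i : ℝ))) := by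
      intro st
      have h2 : ∀ ω : Finset (Fin N) × Finset (Fin N) × (Fin (t + 1) → Finset (Fin N)),
          Real.exp (s * ∑ j ∈ Icc 1 (t + 1),
            ((if i ∈ (nextState k ℓ lam η (t + 1) st ω).avail j then 1 else 0) - (a i : ℝ))) =
          Real.exp (s * ∑ j ∈ Icc 1 t, ((if i ∈ st.avail j then 1 else 0) - (a i : ℝ))) *
            Real.exp (s * ((if i ∈ ω.1 then 1 else 0) - (a i : ℝ))) := by
        intro ω
        rw [← Real.exp_add, ← mul_add, Finset.sum_Icc_succ_top (by omega)]
        congr 3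
        · refine Finset.sum_congr rfl fun j hj => ?_
          have : j ≠ t + 1 := by have := (Finset.mem_Icc.1 hj).2; omega
          simp [nextState, this]
        · simp [nextState]
      rw [expect_congr fun ω _ => h2 ω, expect_const_mul, mul_comm,
        expect_draw_avail fun S => Real.exp (s * ((if i ∈ S then 1 else 0) - (a i : ℝ)))]
      refine mul_le_mul_of_nonneg_right ?_ (Real.exp_pos _).le
      have := expect_exp_le (availabilityLaw a) (f := fun S => if i ∈ S then 1 else 0)
        (fun S => by split_ifs <;> simp) s
      rwa [expect_availabilityLaw_mem] at this
    rw [expect_run_succ]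
    refine (expect_mono (finite_support_run t) fun st _ => h1 st).trans ?_
    rw [expect_const_mul]
    refine (mul_le_mul_of_nonneg_left ih (Real.exp_pos _).le).trans ?_
    rw [← Real.exp_add]
    refine Real.exp_le_exp.2 (le_of_eq ?_)
    push_cast
    ring

theorem empiricalFreq_sub (avail : ℕ → Finset (Fin N)) {t : ℕ} (ht : 1 ≤ t) (i : Fin N) (c : ℝ) :
    (t : ℝ) * (empiricalFreq avail t i - c) =
      ∑ j ∈ Icc 1 t, ((if i ∈ avail j then 1 else 0) - c) := by
  have ht0 : (t : ℝ) ≠ 0 := by positivity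
  rw [Finset.sum_sub_distrib, Finset.sum_boole]
  simp only [empiricalFreq, Finset.sum_const, Nat.card_Icc, add_tsub_cancel_right, nsmul_eq_mul]
  field_simp

theorem expect_run_empiricalFreq_tail_le {t : ℕ} (ht : 1 ≤ t) (i : Fin N) {ε : ℝ} (hε : 0 ≤ ε) :
    expect (run k rule a ℓ lam η t)
      (fun st => if ε < |(empiricalFreq st.avail t i : ℝ) - a i| then 1 else 0) ≤
      2 * Real.exp (-(2 * t * ε ^ 2)) := by
  have ht0 : (0 : ℝ) < t := by exact_mod_cast ht
  have h := expect_tail_le (finite_support_run (k := k) (rule := rule) (a := a) (ℓ := ℓ)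
    (lam := lam) (η := η) t) (r := t * ε) ht0 (by positivity)
    (fun s => expect_run_exp_avail_le i s t)
  have h2 : 2 * (t * ε) ^ 2 / (t : ℝ) = 2 * t * ε ^ 2 := by field_simp
  rw [h2] at h
  refine le_of_eq_of_le (expect_congr fun st _ => ?_) h
  rw [← empiricalFreq_sub _ ht, abs_mul, abs_of_pos ht0]
  simp [ht0]

/-- Two errors add up: the Monte Carlo mean against its expectation under the empirical law, at most
`ε`, and the empirical law against the true one, at most `2 * N * ε` in total variation when every
frequency is `ε`-accurate. A union bound covers the exceptions. -/
theorem missProb_le (hk : 1 ≤ k) {t : ℕ} (ht : 1 ≤ t) {st : State N} (hw : ∀ i, 0 < st.weight i)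
    (i : Fin N) {ε l : ℝ} (hε : 0 ≤ ε) (hl : min 1 ((2 * N + 1) * ε) ≤ l) :
    missProb k rule a t l i st ≤ 2 * Real.exp (-(2 * t * ε ^ 2)) +
      ∑ j, expect (draw k rule a t st) (fun ω =>
        if ε < |(empiricalFreq (Function.update st.avail t ω.1) t j : ℝ) - a j|
          then 1 else 0) := by
  set D := draw k rule a t st with hD
  set F := fun S => empiricalFreq (Function.update st.avail t S) t with hF
  have hq := fun S => scaledProb_mem_Icc hk S hw i
  have h1 : missProb k rule a t l i st ≤ expect D (fun ω =>
      (if ε < |monteCarlo k t st.weight ω.2.2 i -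
        expect (availabilityLaw (F ω.1)) (fun S => scaledProb k S st.weight i)| then 1 else 0) +
      ∑ j, if ε < |(F ω.1 j : ℝ) - a j| then 1 else 0) := by
    refine expect_mono (Set.toFinite _) fun ω _ => ?_
    have hnn : ∀ j, (0 : ℝ) ≤ if ε < |(F ω.1 j : ℝ) - a j| then 1 else 0 := fun j => by
      split_ifs <;> norm_num
    have hs := Finset.sum_nonneg fun j (_ : j ∈ (univ : Finset (Fin N))) => hnn j
    by_cases hA : ε < |monteCarlo k t st.weight ω.2.2 i -
        expect (availabilityLaw (F ω.1)) (fun S => scaledProb k S st.weight i)|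
    · rw [if_pos hA]
      split_ifs <;> linarith
    rw [if_neg hA, zero_add]
    by_cases hB : ∃ j, ε < |(F ω.1 j : ℝ) - a j|
    · obtain ⟨j, hj⟩ := hB
      have h2 := Finset.single_le_sum (fun j _ => hnn j) (Finset.mem_univ j)
      rw [if_pos hj] at h2
      refine le_trans ?_ h2
      split_ifs <;> norm_num
    push Not at hA hB
    rw [if_neg]
    · exact hs
    rw [not_lt]
    -- The entry `1` of the minimum is harmless, because both quantities lie in `[0, 1]`.
    refine le_trans (le_min ?_ ?_) hl
    · have h3 := monteCarlo_mem_Icc hk hw ω.2.2 i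
      have h4 := playProb_mem_Icc (a := a) hk hw i
      exact abs_sub_le_iff.2 ⟨by linarith [h3.2, h4.1], by linarith [h3.1, h4.2]⟩
    · have h3 := abs_expect_availabilityLaw_sub_le (F ω.1) a hq
      have h4 : ∑ j, |(F ω.1 j : ℝ) - a j| ≤ N * ε := by
        refine (Finset.sum_le_card_nsmul _ _ ε fun j _ => hB j).trans (by simp)
      have h5 := abs_sub_le (monteCarlo k t st.weight ω.2.2 i)
        (expect (availabilityLaw (F ω.1)) (fun S => scaledProb k S st.weight i))
        (playProb k a st.weight i)
      change |_ - playProb k a st.weight i| ≤ _ at h3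
      linarith
  rw [expect_add (Set.toFinite _), expect_sum (Set.toFinite _)] at h1
  refine h1.trans (add_le_add_left ?_ _)
  rw [hD, expect_draw, ← expect_const (availabilityLaw a) (2 * _)]
  refine expect_mono (Set.toFinite _) fun S _ => ?_
  rw [← expect_const (playLaw k rule S st.weight) (2 * _)]
  refine expect_mono (Set.toFinite _) fun Ω _ => ?_
  exact expect_iidLaw_tail_le ht (availabilityLaw (F S)) hq hε

theorem expect_run_missProb_le (hk : 1 ≤ k) (t : ℕ) (i : Fin N) {ε l : ℝ} (hε : 0 ≤ ε)
    (hl : min 1 ((2 * N + 1) * ε) ≤ l) :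
    expect (run k rule a ℓ lam η t) (missProb k rule a (t + 1) l i) ≤
      (N + 1) * (2 * Real.exp (-(2 * (t + 1 : ℕ) * ε ^ 2))) := by
  have hfin := finite_support_run (k := k) (rule := rule) (a := a) (ℓ := ℓ) (lam := lam) (η := η) t
  refine (expect_mono hfin fun st hst => missProb_le hk (Nat.succ_pos t)
    (weight_pos_of_mem_support_run hst) i hε hl).trans ?_
  rw [expect_add hfin, expect_const, expect_sum hfin]
  have h1 : ∀ j, expect (run k rule a ℓ lam η t) (fun st => expect (draw k rule a (t + 1) st)
      (fun ω => if ε < |(empiricalFreq (Function.update st.avail (t + 1) ω.1) (t + 1) j : ℝ) - a j|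
        then 1 else 0)) ≤ 2 * Real.exp (-(2 * (t + 1 : ℕ) * ε ^ 2)) := fun j => by
    have := expect_run_empiricalFreq_tail_le (k := k) (rule := rule) (a := a) (ℓ := ℓ)
      (lam := lam) (η := η) (Nat.succ_pos t) j hε
    -- The frequencies include the set of the current round, so their tail is that of the run after
    -- `t + 1` rounds, unfolded by one round.
    rwa [expect_run_succ] at this
  have h2 := Finset.sum_le_card_nsmul univ _ _ fun j _ => h1 j
  rw [Finset.card_univ, Fintype.card_fin, nsmul_eq_mul] at h2
  refine (add_le_add_right h2 _).trans (le_of_eq ?_)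
  ring

/-- The loss of the algorithm minus that of the policy `π` in the first `t` rounds. -/
def pathRegret (π : Policy N k) (ℓ : ℕ → Fin N → ℝ) (t : ℕ) (st : State N) : ℝ :=
  ∑ j ∈ Icc 1 t, ∑ i ∈ st.play j, ℓ j i - ∑ j ∈ Icc 1 t, ∑ i ∈ π.1 (st.avail j), ℓ j i

theorem pathRegret_nextState (π : Policy N k) (t : ℕ) (st : State N)
    (ω : Finset (Fin N) × Finset (Fin N) × (Fin (t + 1) → Finset (Fin N))) :
    pathRegret π ℓ (t + 1) (nextState k ℓ lam η (t + 1) st ω) = pathRegret π ℓ t st +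
      (∑ i ∈ ω.2.1, ℓ (t + 1) i - ∑ i ∈ π.1 ω.1, ℓ (t + 1) i) := by
  have h : ∀ j ∈ Icc 1 t, j ≠ t + 1 := fun j hj => by
    have := (Finset.mem_Icc.1 hj).2; omega
  have h1 : ∑ j ∈ Icc 1 t, ∑ i ∈ (nextState k ℓ lam η (t + 1) st ω).play j, ℓ j i =
      ∑ j ∈ Icc 1 t, ∑ i ∈ st.play j, ℓ j i :=
    Finset.sum_congr rfl fun j hj => by simp [nextState, h j hj]
  have h2 : ∑ j ∈ Icc 1 t, ∑ i ∈ π.1 ((nextState k ℓ lam η (t + 1) st ω).avail j), ℓ j i =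
      ∑ j ∈ Icc 1 t, ∑ i ∈ π.1 (st.avail j), ℓ j i :=
    Finset.sum_congr rfl fun j hj => by simp [nextState, h j hj]
  rw [pathRegret, Finset.sum_Icc_succ_top (by omega), Finset.sum_Icc_succ_top (by omega), h1, h2]
  simp only [nextState, Function.update_self, pathRegret]
  ring

theorem expect_pathRegret_succ (π : Policy N k) (t : ℕ) :
    expect (run k rule a ℓ lam η (t + 1)) (pathRegret π ℓ (t + 1)) =
      expect (run k rule a ℓ lam η t) (pathRegret π ℓ t) +
      expect (run k rule a ℓ lam η t) fun st => expect (draw k rule a (t + 1) st) fun ω =>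
        ∑ i ∈ ω.2.1, ℓ (t + 1) i - ∑ i ∈ π.1 ω.1, ℓ (t + 1) i := by
  rw [expect_run_succ, ← expect_add (finite_support_run t)]
  refine expect_congr fun st _ => ?_
  rw [expect_congr fun ω _ => pathRegret_nextState π t st ω, expect_add (Set.toFinite _),
    expect_const]

/-- The one-round inequality telescopes in the policy potential; `β` bounds the miss probabilities
only on average over the run, which suffices because they enter linearly. -/
theorem expect_pathRegret_le (hk : 1 ≤ k)
    (hrule : ∀ p, IsScaledCapped k p → IsMixture k p (rule p)) (π : Policy N k) (hη : 0 ≤ η)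
    {β : ℝ} (T : ℕ) (hℓ : ∀ t ∈ Icc 1 T, ∀ i, 0 ≤ ℓ t i ∧ ℓ t i ≤ 1)
    (hlam : ∀ t ∈ Icc 1 T, 0 < lam t)
    (hβ : ∀ t < T, ∀ i, expect (run k rule a ℓ lam η t)
      (missProb k rule a (t + 1) (lam (t + 1)) i) ≤ β) :
    η * expect (run k rule a ℓ lam η T) (pathRegret π ℓ T) + policyPotential a π (fun _ => 1) ≤
      expect (run k rule a ℓ lam η T) (fun st => policyPotential a π st.weight) +
      ∑ t ∈ Icc 1 T, N * (η * (2 * lam t + (1 + 1 / lam t) * β) +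
        η ^ 2 * (1 + 1 / lam t ^ 2 * β)) := by
  induction T with
  | zero => simp [run, expect_pure, pathRegret]
  | succ T ih =>
    have ih' := ih (fun t ht => hℓ t (Finset.Icc_subset_Icc_right (by omega) ht))
      (fun t ht => hlam t (Finset.Icc_subset_Icc_right (by omega) ht))
      fun t ht => hβ t (by omega)
    have hT : T + 1 ∈ Icc 1 (T + 1) := by simp
    have hl := hlam _ hT
    have hfin := finite_support_run (k := k) (rule := rule) (a := a) (ℓ := ℓ) (lam := lam)
      (η := η) T
    have h1 := expect_mono hfin fun st hst => expect_draw_regret_le (η := η) (ℓ := ℓ) (lam := lam)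
      (t := T + 1) hk hrule (weight_pos_of_mem_support_run hst) π (a := a)
      (fun i => hℓ _ hT i) hl hη
    rw [expect_add hfin, expect_add hfin, expect_const_mul, expect_sum hfin,
      ← expect_run_succ T fun st => policyPotential a π st.weight] at h1
    have h2 : ∑ i, expect (run k rule a ℓ lam η T) (fun st =>
        η * (2 * lam (T + 1) + (1 + 1 / lam (T + 1)) *
          missProb k rule a (T + 1) (lam (T + 1)) i st) +
        η ^ 2 * (1 + 1 / lam (T + 1) ^ 2 * missProb k rule a (T + 1) (lam (T + 1)) i st)) ≤
        N * (η * (2 * lam (T + 1) + (1 + 1 / lam (T + 1)) * β) +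
          η ^ 2 * (1 + 1 / lam (T + 1) ^ 2 * β)) := by
      refine (Finset.sum_le_card_nsmul _ _ (η * (2 * lam (T + 1) + (1 + 1 / lam (T + 1)) * β) +
        η ^ 2 * (1 + 1 / lam (T + 1) ^ 2 * β)) fun i _ => ?_).trans (by
          rw [Finset.card_univ, Fintype.card_fin, nsmul_eq_mul])
      simp only [expect_add hfin, expect_const_mul, expect_const]
      have := hβ T (by omega) i
      gcongr
    rw [expect_pathRegret_succ, Finset.sum_Icc_succ_top (by omega)]
    linarith

/-- For `k = N` the prescribed `η` is zero and cannot be divided by, but then algorithm and policy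
both play every available arm. -/
theorem expect_pathRegret_eq_zero (hk : 1 ≤ k)
    (hrule : ∀ p, IsScaledCapped k p → IsMixture k p (rule p)) (π : Policy N k) (hkN : k = N)
    (T : ℕ) : expect (run k rule a ℓ lam η T) (pathRegret π ℓ T) = 0 := by
  induction T with
  | zero => simp [run, expect_pure, pathRegret]
  | succ T ih =>
    rw [expect_pathRegret_succ, ih, zero_add, ← expect_const (run k rule a ℓ lam η T) 0]
    refine expect_congr fun st hst => ?_
    have hw := weight_pos_of_mem_support_run hst
    rw [expect_draw_regret hk hrule hw]
    refine Finset.sum_eq_zero fun i _ => ?_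
    have : playProb k a st.weight i = policyProb a π i := by
      refine expect_congr fun S _ => ?_
      have hS : #S ≤ k := (Finset.card_le_univ S).trans (by simp [hkN])
      have hπ : π.1 S = S :=
        Finset.eq_of_subset_of_card_le (π.2 S).1 (by rw [(π.2 S).2, min_eq_right hS])
      rw [scaledProb_of_card_le hk hS hw, hπ]
    rw [this, sub_self, zero_mul]

theorem regret_le (T : ℕ) {C : ℝ}
    (h : ∀ π : Policy N k, expect (run k rule a ℓ lam η T) (pathRegret π ℓ T) ≤ C) :
    regret k rule a ℓ lam η T ≤ C := by
  refine ciSup_le fun π => le_of_eq_of_le ?_ (h π)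
  rw [integral_toMeasure_eq_expect (finite_support_run T)]
  rfl

end Run

/-! ### The parameters -/

section Parameters

theorem sum_one_div_sqrt_le (T : ℕ) : ∑ t ∈ Icc 1 T, 1 / √(t : ℝ) ≤ 2 * √T := by
  induction T with
  | zero => simp
  | succ T ih =>
    rw [Finset.sum_Icc_succ_top (by omega)]
    have h1 : (0 : ℝ) < √((T + 1 : ℕ) : ℝ) := Real.sqrt_pos.2 (by positivity)
    have h2 : √((T + 1 : ℕ) : ℝ) ^ 2 = T + 1 := by rw [Real.sq_sqrt (by positivity)]; simp
    have h3 : √(T : ℝ) ^ 2 = T := Real.sq_sqrt (by positivity)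
    have h4 : 1 / √((T + 1 : ℕ) : ℝ) ≤ 2 * (√((T + 1 : ℕ) : ℝ) - √(T : ℝ)) := by
      rw [div_le_iff₀ h1]
      nlinarith [sq_nonneg (√((T + 1 : ℕ) : ℝ) - √(T : ℝ))]
    linarith

variable {N k T : ℕ}

theorem log_div_deltaParam (hN : 1 ≤ N) (hT : 2 ≤ T) :
    Real.log (2 * N / deltaParam N T) = Real.log (2 * (T : ℝ) ^ 2) := by
  have hN0 : (0 : ℝ) < N := by exact_mod_cast hN
  have hT0 : (0 : ℝ) < T := by exact_mod_cast (by omega : 0 < T)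
  rw [deltaParam]
  congr 1
  field_simp

theorem one_le_log_two_mul_sq (hT : 2 ≤ T) : 1 ≤ Real.log (2 * (T : ℝ) ^ 2) := by
  have hT0 : (2 : ℝ) ≤ T := by exact_mod_cast hT
  rw [Real.le_log_iff_exp_le (by positivity)]
  nlinarith [Real.exp_one_lt_d9]

theorem log_two_mul_sq_le (hT : 2 ≤ T) : Real.log (2 * (T : ℝ) ^ 2) ≤ 3 * Real.log T := by
  have hT0 : (2 : ℝ) ≤ T := by exact_mod_cast hT
  rw [Real.log_mul two_ne_zero (by positivity), Real.log_pow]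
  have := Real.log_le_log two_pos hT0
  push_cast
  linarith

/-- Concentration needs only `2 * N + 1 ≤ 4 * N` in front of the root; the factor `k` and the second
summand are surplus. -/
theorem le_lamParam (hk : 1 ≤ k) (hkN : k ≤ N) (hT : 2 ≤ T) (t : ℕ) :
    min 1 (4 * N * √(Real.log (2 * (T : ℝ) ^ 2) / t)) ≤ lamParam N k (deltaParam N T) t := by
  have hk0 : (1 : ℝ) ≤ k := by exact_mod_cast hk
  have hL := one_le_log_two_mul_sq hT
  rw [lamParam, log_div_deltaParam (hk.trans hkN) hT]
  refine min_le_min_left _ ?_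
  refine le_add_of_le_of_nonneg (mul_le_mul_of_nonneg_right ?_ (Real.sqrt_nonneg _)) (by positivity)
  nlinarith [(Nat.cast_nonneg N : (0 : ℝ) ≤ N)]

theorem one_div_sqrt_le_lamParam (hk : 1 ≤ k) (hkN : k ≤ N) (hT : 2 ≤ T) {t : ℕ}
    (ht : t ∈ Icc 1 T) : 1 / √(T : ℝ) ≤ lamParam N k (deltaParam N T) t := by
  obtain ⟨ht1, htT⟩ := Finset.mem_Icc.1 ht
  have hN : (1 : ℝ) ≤ N := by exact_mod_cast hk.trans hkN
  have ht0 : (1 : ℝ) ≤ t := by exact_mod_cast ht1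
  have htT' : (t : ℝ) ≤ T := by exact_mod_cast htT
  have hL := one_le_log_two_mul_sq hT
  refine le_trans (le_min ?_ ?_) (le_lamParam hk hkN hT t)
  · exact div_le_one_of_le₀ (Real.one_le_sqrt.2 (by linarith)) (Real.sqrt_nonneg _)
  · have h1 : 1 / √(T : ℝ) ≤ √(Real.log (2 * (T : ℝ) ^ 2) / t) := by
      rw [← Real.sqrt_one, ← Real.sqrt_div zero_le_one]
      exact Real.sqrt_le_sqrt (div_le_div₀ (by linarith) hL (by linarith) htT')
    have h2 := Real.sqrt_nonneg (Real.log (2 * (T : ℝ) ^ 2) / t)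
    nlinarith

theorem lamParam_le (hk : 1 ≤ k) (hkN : k ≤ N) (hT : 2 ≤ T) {t : ℕ} (ht : 1 ≤ t) :
    lamParam N k (deltaParam N T) t ≤
      7 * k * N * √(Real.log (2 * (T : ℝ) ^ 2)) * (1 / √(t : ℝ)) := by
  have hk0 : (1 : ℝ) ≤ k := by exact_mod_cast hk
  have hN : (1 : ℝ) ≤ N := by exact_mod_cast hk.trans hkN
  have ht0 : (1 : ℝ) ≤ t := by exact_mod_cast ht
  have hL := one_le_log_two_mul_sq hT
  rw [lamParam, log_div_deltaParam (hk.trans hkN) hT]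
  set L := Real.log (2 * (T : ℝ) ^ 2)
  have h1 : √L * (1 / √(t : ℝ)) = √(L / t) := by
    rw [Real.sqrt_div (by linarith)]; ring
  rw [mul_assoc (7 * k * N : ℝ), h1]
  have hkN1 : 1 ≤ (k : ℝ) * N := one_le_mul_of_one_le_of_one_le hk0 hN
  -- For `L / t ≤ 1` the second summand is absorbed by the root, and `4 + 8 / 3 ≤ 7`; otherwise the
  -- cap at `1` suffices.
  rcases le_total (L / t) 1 with h | h
  · refine (min_le_right _ _).trans ?_
    have h2 : L / t ≤ √(L / t) := Real.le_sqrt_of_sq_le (by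
      have : 0 ≤ L / t := by positivity
      nlinarith)
    have h3 : 8 * k * N * L / (3 * t) = (8 / 3 * (k * N)) * (L / t) := by
      field_simp
    rw [h3]
    have h4 : (8 / 3 * (k * N)) * (L / t) ≤ (8 / 3 * (k * N)) * √(L / t) := by gcongr
    have h5 : 0 ≤ (k * N) * √(L / t) := by positivity
    linarith
  · refine (min_le_left _ _).trans ?_
    have h2 : 1 ≤ √(L / t) := Real.one_le_sqrt.2 h
    nlinarith

theorem sqrt_natCast_le (hT : 2 ≤ T) : √(T : ℝ) ≤ 2 * √(T * Real.log T) := by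
  have hT0 : (2 : ℝ) ≤ T := by exact_mod_cast hT
  have hlog := Real.log_le_log two_pos hT0
  have : (2 : ℝ) = √4 := by
    rw [show (4 : ℝ) = 2 ^ 2 by norm_num, Real.sqrt_sq two_pos.le]
  rw [this, ← Real.sqrt_mul (by norm_num)]
  refine Real.sqrt_le_sqrt ?_
  nlinarith [Real.log_two_gt_d9]

theorem one_le_sqrt_mul_log (hT : 2 ≤ T) : 1 ≤ √(T * Real.log T) := by
  have hT0 : (2 : ℝ) ≤ T := by exact_mod_cast hT
  have hlog := Real.log_le_log two_pos hT0
  refine Real.one_le_sqrt.2 ?_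
  nlinarith [Real.log_two_gt_d9]

end Parameters

/-! ### Assembling the regret bound. -/

section Bound

variable {N k T : ℕ} {rule : (Fin N → ℝ) → PMF (Finset (Fin N))} {a : Fin N → Set.Icc (0 : ℝ) 1}
  {ℓ : ℕ → Fin N → ℝ} {η : ℝ}

theorem expect_run_missProb_lamParam_le (hk : 1 ≤ k) (hkN : k ≤ N) (hT : 2 ≤ T) (t : ℕ)
    (i : Fin N) {lam : ℕ → ℝ} :
    expect (run k rule a ℓ lam η t)
      (missProb k rule a (t + 1) (lamParam N k (deltaParam N T) (t + 1)) i) ≤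
      N / (T : ℝ) ^ 4 := by
  have hN : (1 : ℝ) ≤ N := by exact_mod_cast hk.trans hkN
  have hT0 : (0 : ℝ) < T := by exact_mod_cast (by omega : 0 < T)
  have hL := one_le_log_two_mul_sq hT
  set L := Real.log (2 * (T : ℝ) ^ 2) with hLdef
  -- The accuracy `ε = √(L / (t + 1))` turns the tail into `2 * exp (-2 * L) = 1 / (2 * T ^ 4)`, and
  -- `(N + 1) / 2 ≤ N`.
  have hl : min 1 ((2 * N + 1) * √(L / (t + 1 : ℕ))) ≤
      lamParam N k (deltaParam N T) (t + 1) := by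
    refine le_trans (min_le_min_left _ ?_) (le_lamParam hk hkN hT (t + 1))
    exact mul_le_mul_of_nonneg_right (by linarith) (Real.sqrt_nonneg _)
  refine (expect_run_missProb_le hk t i (Real.sqrt_nonneg _) hl).trans ?_
  rw [Real.sq_sqrt (by positivity)]
  have h1 : -(2 * ((t + 1 : ℕ) : ℝ) * (L / (t + 1 : ℕ))) = -L + -L := by
    field_simp
    ring
  rw [h1, Real.exp_add, Real.exp_neg, hLdef, Real.exp_log (by positivity)]
  have h2 : (N + 1 : ℝ) * (2 * ((2 * (T : ℝ) ^ 2)⁻¹ * (2 * (T : ℝ) ^ 2)⁻¹)) =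
      (N + 1) / 2 / (T : ℝ) ^ 4 := by field_simp
  rw [h2]
  gcongr
  linarith

/-- Since `λ_t ≥ 1 / √T`, the factors `1 / λ_t` and `1 / λ_t²` are at most `√T` and `T`, which the
miss probability `N / T ^ 4` absorbs. The constant `58` is `14 * 4` from the sum of the `λ_t` plus
`2` from the misses. -/
theorem sum_error_le (hk : 1 ≤ k) (hkN : k ≤ N) (hT : 2 ≤ T) (hη : 0 ≤ η) :
    ∑ t ∈ Icc 1 T, N * (η * (2 * lamParam N k (deltaParam N T) t +
        (1 + 1 / lamParam N k (deltaParam N T) t) * (N / (T : ℝ) ^ 4)) +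
        η ^ 2 * (1 + 1 / lamParam N k (deltaParam N T) t ^ 2 * (N / (T : ℝ) ^ 4))) ≤
      η * (58 * k * (N : ℝ) ^ 2 * √(T * Real.log T)) + η ^ 2 * (2 * (N : ℝ) ^ 2 * T) := by
  have hN : (1 : ℝ) ≤ N := by exact_mod_cast hk.trans hkN
  have hk0 : (1 : ℝ) ≤ k := by exact_mod_cast hk
  have hT0 : (2 : ℝ) ≤ T := by exact_mod_cast hT
  have hTpos : (0 : ℝ) < T := by linarith
  set L := Real.log (2 * (T : ℝ) ^ 2) with hLdef
  have hsT : 0 < √(T : ℝ) := Real.sqrt_pos.2 hTpos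
  have hsT2 : √(T : ℝ) ^ 2 = T := Real.sq_sqrt hTpos.le
  have hsTle : √(T : ℝ) ≤ T := Real.sqrt_le_iff.2 ⟨hTpos.le, by nlinarith⟩
  set G := √(T * Real.log T) with hG
  have hG1 : 1 ≤ G := one_le_sqrt_mul_log hT
  have hterm : ∀ t ∈ Icc 1 T, N * (η * (2 * lamParam N k (deltaParam N T) t +
        (1 + 1 / lamParam N k (deltaParam N T) t) * (N / (T : ℝ) ^ 4)) +
        η ^ 2 * (1 + 1 / lamParam N k (deltaParam N T) t ^ 2 * (N / (T : ℝ) ^ 4))) ≤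
      N * (η * (14 * k * N * √L * (1 / √(t : ℝ)) + 2 * N / T) + η ^ 2 * (2 * N)) := by
    intro t ht
    have h1 := one_div_sqrt_le_lamParam hk hkN hT ht
    have h2 := lamParam_le hk hkN hT (Finset.mem_Icc.1 ht).1
    rw [← hLdef] at h2
    set l := lamParam N k (deltaParam N T) t
    have hl : 0 < l := (by positivity : 0 < 1 / √(T : ℝ)).trans_le h1
    have h3 : 1 / l ≤ √(T : ℝ) := by
      rw [div_le_iff₀ hsT] at h1
      rw [div_le_iff₀ hl]
      linarith
    have h4 : 1 / l ^ 2 ≤ T := by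
      rw [← hsT2, ← one_div_pow]
      exact pow_le_pow_left₀ (by positivity) h3 2
    have h5 : (1 + 1 / l) * (N / (T : ℝ) ^ 4) ≤ 2 * N / T := by
      have h6 : 1 + 1 / l ≤ 2 * T := by linarith
      calc (1 + 1 / l) * (N / (T : ℝ) ^ 4) ≤ (2 * T) * (N / (T : ℝ) ^ 4) := by gcongr
        _ = 2 * N / (T : ℝ) ^ 3 := by field_simp
        _ ≤ 2 * N / T := by
          gcongr
          exact le_self_pow₀ (by linarith) (by norm_num)
    have h6 : 1 / l ^ 2 * (N / (T : ℝ) ^ 4) ≤ N := by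
      calc 1 / l ^ 2 * (N / (T : ℝ) ^ 4) ≤ T * (N / (T : ℝ) ^ 4) := by gcongr
        _ = N / (T : ℝ) ^ 3 := by field_simp
        _ ≤ N := div_le_self (by linarith) (one_le_pow₀ (by linarith))
    have h7 : 2 * l + (1 + 1 / l) * (N / (T : ℝ) ^ 4) ≤
        14 * k * N * √L * (1 / √(t : ℝ)) + 2 * N / T := by linarith
    have h8 : 1 + 1 / l ^ 2 * (N / (T : ℝ) ^ 4) ≤ 2 * N := by linarith
    gcongr
  refine (Finset.sum_le_sum hterm).trans ?_
  rw [← Finset.mul_sum, Finset.sum_add_distrib, ← Finset.mul_sum, Finset.sum_add_distrib,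
    ← Finset.mul_sum]
  simp only [Finset.sum_const, Nat.card_Icc, add_tsub_cancel_right, nsmul_eq_mul]
  have h1 : √L * (∑ t ∈ Icc 1 T, 1 / √(t : ℝ)) ≤ 4 * G := by
    have h2 : √L ≤ 2 * √(Real.log T) := by
      have h3 : (2 : ℝ) = √4 := by
        rw [show (4 : ℝ) = 2 ^ 2 by norm_num, Real.sqrt_sq two_pos.le]
      rw [h3, ← Real.sqrt_mul (by norm_num)]
      refine Real.sqrt_le_sqrt ((log_two_mul_sq_le hT).trans ?_)
      linarith [Real.log_nonneg (by linarith : (1 : ℝ) ≤ T)]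
    have h4 := mul_le_mul h2 (sum_one_div_sqrt_le T)
      (Finset.sum_nonneg fun t _ => by positivity) (by positivity)
    have h5 : G = √(T : ℝ) * √(Real.log T) := Real.sqrt_mul hTpos.le _
    rw [h5]
    linarith
  have h2 : 14 * k * N * √L * (∑ t ∈ Icc 1 T, 1 / √(t : ℝ)) + T * (2 * N / T) ≤
      58 * k * N * G := by
    have h3 : (T : ℝ) * (2 * N / T) = 2 * N := by field_simp
    have h4 := mul_le_mul_of_nonneg_left h1 (by positivity : (0 : ℝ) ≤ 14 * k * N)
    have h5 : 2 * (N : ℝ) ≤ 2 * (k * N * G) := by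
      have : 1 ≤ (k : ℝ) * G := one_le_mul_of_one_le_of_one_le hk0 hG1
      nlinarith
    rw [h3]
    linarith
  have h3 := mul_le_mul_of_nonneg_left h2 (by positivity : (0 : ℝ) ≤ N * η)
  have h4 : (N : ℝ) * (η * (14 * k * N * √L * ∑ t ∈ Icc 1 T, 1 / √(t : ℝ) + T * (2 * N / T)) +
      T * (η ^ 2 * (2 * N))) = N * η * (14 * k * N * √L * (∑ t ∈ Icc 1 T, 1 / √(t : ℝ)) +
      T * (2 * N / T)) + η ^ 2 * (2 * (N : ℝ) ^ 2 * T) := by ring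
  rw [h4]
  linarith

theorem regret_etaParam_le (hk : 1 ≤ k) (hkN : k ≤ N) (hT : 2 ≤ T)
    (hℓ : ∀ t ∈ Icc 1 T, ∀ i, 0 ≤ ℓ t i ∧ ℓ t i ≤ 1)
    (hrule : ∀ p, IsScaledCapped k p → IsMixture k p (rule p)) :
    regret k rule a ℓ (lamParam N k (deltaParam N T)) (etaParam N k T) T ≤
      64 * k * (N : ℝ) ^ 2 * √(T * Real.log T) := by
  have hN : (1 : ℝ) ≤ N := by exact_mod_cast hk.trans hkN
  have hk0 : (1 : ℝ) ≤ k := by exact_mod_cast hk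
  have hT0 : (2 : ℝ) ≤ T := by exact_mod_cast hT
  have hTpos : (0 : ℝ) < T := by linarith
  have hsT := sqrt_natCast_le hT
  refine regret_le T fun π => ?_
  set lam := lamParam N k (deltaParam N T)
  set η := etaParam N k T with hη
  set G := √(T * Real.log T) with hG
  have hG1 : 1 ≤ G := one_le_sqrt_mul_log hT
  rcases hkN.eq_or_lt with h | h
  · rw [expect_pathRegret_eq_zero hk hrule π h T]
    positivity
  have hkN' : (k : ℝ) < N := by exact_mod_cast h
  have hlog : 0 < Real.log (N / k) := Real.log_pos ((one_lt_div (by linarith)).2 hkN')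
  have hlogN : Real.log (N / k) ≤ N := by
    have h1 := Real.log_le_sub_one_of_pos (by positivity : (0 : ℝ) < N / k)
    have h2 : (N : ℝ) / k ≤ N := div_le_self (by linarith) hk0
    linarith
  have hηpos : 0 < η := Real.sqrt_pos.2 (by positivity)
  have hη2 : η ^ 2 = Real.log (N / k) / (N * T) := Real.sq_sqrt (by positivity)
  have hmain := expect_pathRegret_le (a := a) hk hrule π hηpos.le T hℓ
    (fun t ht => (by positivity : 0 < 1 / √(T : ℝ)).trans_le (one_div_sqrt_le_lamParam hk hkN hT ht))
    fun t _ i => expect_run_missProb_lamParam_le hk hkN hT t i (lam := lam) (η := η)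
  have herr := sum_error_le hk hkN hT hηpos.le
  have hΨ : expect (run k rule a ℓ lam η T) (fun st => policyPotential a π st.weight) ≤ 0 := by
    rw [← expect_const (run k rule a ℓ lam η T) 0]
    exact expect_mono (finite_support_run T) fun st hst =>
      policyPotential_nonpos hk π (weight_pos_of_mem_support_run hst)
  have hΨ1 := le_policyPotential_one (a := a) hk hkN π
  -- This uses only `log (N / k) ≤ N`, a generous bound that the factor `N²` from the exploration
  -- error makes affordable.
  have hηT : η * T ≤ √(T : ℝ) := by
    refine Real.le_sqrt_of_sq_le ?_
    rw [mul_pow, hη2]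
    have : Real.log (N / k) / (N * T) * (T : ℝ) ^ 2 = Real.log (N / k) / N * T := by field_simp
    rw [this]
    exact mul_le_of_le_one_left hTpos.le (div_le_one_of_le₀ hlogN (by linarith))
  have hlogη : k * Real.log (N / k) = η * (k * N * (η * T)) := by
    have : η * (k * N * (η * T)) = k * N * T * η ^ 2 := by ring
    rw [this, hη2]
    field_simp
  -- The initial potential was rewritten as a multiple of `η`, so `η` can be cancelled. The
  -- constants are `58` from the errors, `2` from the initial potential and `4` from the quadratic
  -- term.
  refine le_of_mul_le_mul_left ?_ hηpos
  have h1 : k * N * (η * T) ≤ 2 * (k * (N : ℝ) ^ 2 * G) := by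
    have h2 : k * N * (η * T) ≤ k * N * (2 * G) :=
      mul_le_mul_of_nonneg_left (hηT.trans hsT) (by positivity)
    have h3 : k * N * (2 * G) ≤ k * (N * N) * (2 * G) := by
      gcongr
      nlinarith
    linarith
  have h2 : 2 * (N : ℝ) ^ 2 * (η * T) ≤ 4 * (k * (N : ℝ) ^ 2 * G) := by
    have h3 : 2 * (N : ℝ) ^ 2 * (η * T) ≤ 2 * (N : ℝ) ^ 2 * (2 * G) :=
      mul_le_mul_of_nonneg_left (hηT.trans hsT) (by positivity)
    have h4 : (N : ℝ) ^ 2 * G ≤ k * ((N : ℝ) ^ 2 * G) :=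
      le_mul_of_one_le_left (by positivity) hk0
    linarith
  have h3 := mul_le_mul_of_nonneg_left (add_le_add h1 h2) hηpos.le
  linarith

end Bound

end SleepingBandit

end

theorem mainTheorem2 :
    ∃ C : ℝ, 0 < C ∧
      ∀ (N k T : ℕ), 1 ≤ k → k ≤ N → 2 ≤ T →
      ∀ (a : Fin N → Set.Icc (0 : ℝ) 1) (ℓ : ℕ → Fin N → ℝ),
        (∀ t ∈ Finset.Icc 1 T, ∀ i, 0 ≤ ℓ t i ∧ ℓ t i ≤ 1) →
      ∀ rule : (Fin N → ℝ) → PMF (Finset (Fin N)),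
        (∀ p, SleepingBandit.IsScaledCapped k p → SleepingBandit.IsMixture k p (rule p)) →
        SleepingBandit.regret k rule a ℓ
            (SleepingBandit.lamParam N k (SleepingBandit.deltaParam N T))
            (SleepingBandit.etaParam N k T) T
          ≤ C * k * (N : ℝ) ^ 2 * √(T * Real.log T) :=
  ⟨64, by norm_num, fun _ _ _ hk hkN hT _ _ hℓ _ hrule =>
    SleepingBandit.regret_etaParam_le hk hkN hT hℓ hrule⟩
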